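/- There are one target task ($k=0$, sample size $n_T$) and $K\ge 1$ source tasks ($k=1,\dots,K$, sample size $n_S$ each); put $n_0=n_T$, $n_k=n_S$ for $k\ge1$, and $N=Kn_S+n_T$. The observations follow the linear models $y^{(k)}_i=\langle X^{(k)}_i,\beta^{(k)}\rangle+\epsilon^{(k)}_i$ in $\mathbb R^p$, $1\le i\le n_k$. Designs: within each task the rows $X^{(k)}_i$ are independent, have mean zero and covariance matrix $\Sigma^{(k)}$, and are sub-Gaussian with variance proxy $\kappa$, i.e. $\mathbb E e^{t\langle X^{(k)}_i,u\rangle}\le e^{\kappa t^2/2}$ for all $t\in\mathbb R$ and all unit vectors $u$; all eigenvalues of all $\Sigma^{(k)}$ lie in $[1/c_\Sigma,c_\Sigma]$. The covariances may differ across tasks. Errors: all the $\epsilon^{(k)}_i$, $0\le k\le K$, $1\le i\le n_k$, are jointly independent centred Gaussian variables with variances at most $V$, independent of all the designs. Parameters: $\|\beta^{(0)}\|_0\le s$ with $s\ge1$, and $\|\beta^{(k)}-\beta^{(0)}\|_1\le h_k$ for $1\le k\le K$. Put $\bar h=\frac{n_S}{N}\sum_{k=1}^K h_k$, $v_n=\sqrt{K^2\log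 p/n_S}\,\bar h$, $w=\frac{n_S}{N}\sum_{k=1}^K\beta^{(k)}+\frac{n_T}{N}\beta^{(0)}$, and let $\varepsilon_D$ be any number with $\big\|\frac{n_S}{N}\sum_{k=1}^K(\beta^{(k)}-\beta^{(0)})\big\|_1\le\varepsilon_D$. Estimator: $\hat\beta=(\hat\beta^{(0)},\dots,\hat\beta^{(K)})$ is a minimizer over $\mathbb R^{(K+1)p}$ of $$\frac1{2N}\sum_{k=0}^K\sum_{i=1}^{n_k}\big(y^{(k)}_i-\langle X^{(k)}_i,b^{(k)}\rangle\big)^2+\lambda_0\Big(\|b^{(0)}\|_1+\sum_{k=1}^K a_k\|b^{(k)}-b^{(0)}\|_1\Big),$$ and $\hat w=\frac{n_S}{N}\sum_{k=1}^K\hat\beta^{(k)}+\frac{n_T}{N}\hat\beta^{(0)}$. Theorem. For all $c_\Sigma>0$, $\kappa,V\ge0$ and $A\in\mathbb R$ there are constants $c_0,M,C,c_1,c_2,c_3,c_4>0$, depending only on $c_\Sigma,\kappa,V,A$, such that the following holds for all $K\ge1$, $n_T$, $n_S$, $p$, $s\ge1$, $h$, $\beta$ and all designs and errors as above with $\log K\le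 A\log p$ and $n_S\ge M s\log p$. Take $\lambda_0=c_0\sqrt{\log p/N}$ and $a_k=8\sqrt{n_S/N}$. Then, with probability at least $1-c_1\exp(-c_2n_T)-c_3\exp(-c_4\log p)$, a minimizer $\hat\beta$ exists and every minimizer satisfies both $$\|\hat w-w\|_2^2\le C\Big(\frac{s\log p}{N}+(1+v_n)\bar h\sqrt{\frac{\log p}{n_S}}\Big)$$ and $$\|\hat w-\beta^{(0)}\|_2^2\le C\Big(\frac{s\log p}{N}+(1+v_n)\bar h\sqrt{\frac{\log p}{n_S}}+\varepsilon_D^2\Big).$$ -/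

import Mathlib

open MeasureTheory ProbabilityTheory
open scoped NNReal

universe u

namespace TransFusion

noncomputable section

/-- The sample size of task `k`: task `0` is the target task (`nT` observations), the tasks
`1, …, K` are the source tasks (`nS` observations each). -/
def sampleSize {K : ℕ} (nT nS : ℕ) (k : Fin (K + 1)) : ℕ := if k = 0 then nT else nS

/-- Total sample size `N = K nS + nT`. -/
def totalSize (K nT nS : ℕ) : ℕ := K * nS + nT

/-- The `ℓ₁`-norm of a vector. -/
def l1Norm {p : ℕ} (v : EuclideanSpace ℝ (Fin p)) : ℝ := ∑ j, |v j|

/-- The number of nonzero entries of a vector. -/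
def l0Norm {p : ℕ} (v : EuclideanSpace ℝ (Fin p)) : ℕ := {j : Fin p | v j ≠ 0}.ncard

/-- The parameter space `Θ(s, h)`: the target parameter `β 0` has at most `s` nonzero entries and
the contrast of each source parameter has `ℓ₁`-norm at most `h k`. Source tasks are indexed by
`k : Fin K`, source `k` being task `k.succ`. -/
def paramSpace {K p : ℕ} (s : ℕ) (h : Fin K → ℝ) :
    Set (Fin (K + 1) → EuclideanSpace ℝ (Fin p)) :=
  {β | l0Norm (β 0) ≤ s ∧ ∀ k : Fin K, l1Norm (β k.succ - β 0) ≤ h k}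

/-- The covariance matrix of a random vector. -/
def covMatrix {Ω : Type u} [MeasurableSpace Ω] (μ : Measure Ω) {p : ℕ}
    (Z : Ω → EuclideanSpace ℝ (Fin p)) : Matrix (Fin p) (Fin p) ℝ :=
  Matrix.of fun j l => cov[fun ω => Z ω j, fun ω => Z ω l; μ]

/-- Sub-Gaussian designs: in every task the rows are independent, centred, have covariance matrix
`S k`, and every one-dimensional marginal in a unit direction is sub-Gaussian with variance proxy
`κ`; all eigenvalues of all the matrices `S k` lie in `[1 / c, c]`. -/
structure SubGaussianDesigns {Ω : Type u} [MeasurableSpace Ω] (μ : Measure Ω) {K p nT nS : ℕ}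
    (c : ℝ) (κ : ℝ≥0) (S : Fin (K + 1) → Matrix (Fin p) (Fin p) ℝ)
    (X : (k : Fin (K + 1)) → Fin (sampleSize nT nS k) → Ω → EuclideanSpace ℝ (Fin p)) :
    Prop where
  measurable : ∀ k i, Measurable (X k i)
  indep : ∀ k, iIndepFun (X k) μ
  mean_zero : ∀ k i j, ∫ ω, X k i ω j ∂μ = 0
  cov_eq : ∀ k i, covMatrix μ (X k i) = S k
  subGaussian : ∀ k i (v : EuclideanSpace ℝ (Fin p)), ‖v‖ = 1 →
    HasSubgaussianMGF (fun ω => inner ℝ (X k i ω) v) κ μ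
  eigenvalue_bounds : ∀ k (ev : ℝ), Module.End.HasEigenvalue (Matrix.toLin' (S k)) ev →
    1 / c ≤ ev ∧ ev ≤ c

/-- Gaussian errors: all the errors, over all tasks and all observations, are jointly independent
centred Gaussian variables with variances at most `V`, and they are independent of the designs. -/
structure GaussianErrors {Ω : Type u} [MeasurableSpace Ω] (μ : Measure Ω) {K p nT nS : ℕ}
    (V : ℝ≥0)
    (X : (k : Fin (K + 1)) → Fin (sampleSize nT nS k) → Ω → EuclideanSpace ℝ (Fin p))
    (ε : (k : Fin (K + 1)) → Fin (sampleSize nT nS k) → Ω → ℝ) : Prop where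
  measurable : ∀ k i, Measurable (ε k i)
  indep : iIndepFun
    (fun (q : Σ k : Fin (K + 1), Fin (sampleSize nT nS k)) (ω : Ω) => ε q.1 q.2 ω) μ
  gaussian : ∀ k i, ∃ v : ℝ≥0, v ≤ V ∧ μ.map (ε k i) = gaussianReal 0 v
  indep_design : IndepFun
    (fun (ω : Ω) (q : Σ k : Fin (K + 1), Fin (sampleSize nT nS k)) => X q.1 q.2 ω)
    (fun (ω : Ω) (q : Σ k : Fin (K + 1), Fin (sampleSize nT nS k)) => ε q.1 q.2 ω) μ

/-- The responses of the linear models: `y k i = ⟨x k i, β k⟩ + e k i`. -/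
def response {K p nT nS : ℕ} (β : Fin (K + 1) → EuclideanSpace ℝ (Fin p))
    (x : (k : Fin (K + 1)) → Fin (sampleSize nT nS k) → EuclideanSpace ℝ (Fin p))
    (e : (k : Fin (K + 1)) → Fin (sampleSize nT nS k) → ℝ) :
    (k : Fin (K + 1)) → Fin (sampleSize nT nS k) → ℝ :=
  fun k i => inner ℝ (x k i) (β k) + e k i

/-- The co-training objective
`(1 / 2N) ∑ₖ ‖y k - x k b k‖₂² + lam (‖b 0‖₁ + ∑_{k ≥ 1} a k ‖b k - b 0‖₁)`. -/
def objective {K p nT nS : ℕ} (lam : ℝ) (a : Fin K → ℝ)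
    (x : (k : Fin (K + 1)) → Fin (sampleSize nT nS k) → EuclideanSpace ℝ (Fin p))
    (y : (k : Fin (K + 1)) → Fin (sampleSize nT nS k) → ℝ)
    (b : Fin (K + 1) → EuclideanSpace ℝ (Fin p)) : ℝ :=
  1 / (2 * (totalSize K nT nS : ℝ)) * ∑ k, ∑ i, (y k i - inner ℝ (x k i) (b k)) ^ 2
    + lam * (l1Norm (b 0) + ∑ k : Fin K, a k * l1Norm (b k.succ - b 0))

/-- The set of global minimizers of the co-training objective. -/
def argminSet {K p nT nS : ℕ} (lam : ℝ) (a : Fin K → ℝ)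
    (x : (k : Fin (K + 1)) → Fin (sampleSize nT nS k) → EuclideanSpace ℝ (Fin p))
    (y : (k : Fin (K + 1)) → Fin (sampleSize nT nS k) → ℝ) :
    Set (Fin (K + 1) → EuclideanSpace ℝ (Fin p)) :=
  {b | ∀ b', objective lam a x y b ≤ objective lam a x y b'}

/-- The weighted average `(nS / N) ∑_{k ≥ 1} b k + (nT / N) b 0` of the task parameters. -/
def average {K p : ℕ} (nT nS : ℕ) (b : Fin (K + 1) → EuclideanSpace ℝ (Fin p)) :
    EuclideanSpace ℝ (Fin p) :=
  ((nS : ℝ) / (totalSize K nT nS : ℝ)) • ∑ k : Fin K, b k.succ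
    + ((nT : ℝ) / (totalSize K nT nS : ℝ)) • b 0

/-- The vector `(nS / N) ∑_{k ≥ 1} (b k - b 0)`, whose `ℓ₁`-norm measures the lack of diversity of
the source tasks. -/
def averageContrast {K p : ℕ} (nT nS : ℕ) (b : Fin (K + 1) → EuclideanSpace ℝ (Fin p)) :
    EuclideanSpace ℝ (Fin p) :=
  ((nS : ℝ) / (totalSize K nT nS : ℝ)) • ∑ k : Fin K, (b k.succ - b 0)

/-- `hBar = (nS / N) ∑_{k ≥ 1} h k`. -/
def hBar {K : ℕ} (nT nS : ℕ) (h : Fin K → ℝ) : ℝ :=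
  (nS : ℝ) / (totalSize K nT nS : ℝ) * ∑ k, h k

/-- `vₙ = √(K² log p / nS) hBar`. -/
def vn {K : ℕ} (p nT nS : ℕ) (h : Fin K → ℝ) : ℝ :=
  √((K : ℝ) ^ 2 * Real.log p / nS) * hBar nT nS h

/-- The rate `s log p / N + (1 + vₙ) hBar √(log p / nS)`. -/
def rate {K : ℕ} (p s nT nS : ℕ) (h : Fin K → ℝ) : ℝ :=
  s * Real.log p / (totalSize K nT nS : ℝ)
    + (1 + vn p nT nS h) * hBar nT nS h * √(Real.log p / nS)

end

end TransFusion

/-! Write `u k = b k - β k` for the errors of a minimizer and `w` for the norm of their weighted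
average. Covariances are never compared across tasks: the triangle inequality bounds `N w` by `∑ n_k
‖u k‖`, and Cauchy–Schwarz bounds that by the pooled prediction error, once every task has
restricted curvature.

Curvature: `α n ‖v‖² ≤ ‖X v‖² + ρ log p ‖v‖₁²` for all `v`. By Maurey's empirical method
(`exists_bilin_sum_le`) it suffices to control the quadratic form at the sums of `m` signed basis
vectors. There are at most `(2p)^m` of them, so for `m` of order `n / log p` a union bound over the
lower tail `exp (-γ n)` is affordable. For `n` below a multiple of `log p` the inequality is
trivial, so `nT` may be arbitrary.

Noise: conditionally on the designs, the pooled score has size `√(N log p)` and the score of one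
source `√(nS log p)`. These are the scales of `λ₀` and `λ₀ a_k` (`noise_le`, `exists_goodEvent`).

Deterministic part: the basic inequality yields a cone condition. On the support of `β 0`, `u 0` is
replaced by the average plus a contrast term, which the factor 8 in `a_k` lets one absorb. Pooling
multiplies the curvature loss by `K`. Its sparse part is absorbed by `K nS ≤ N` and `nS ≥ M s log
p`; its contrast part leaves `K (log p / nS) hBar² = vₙ hBar √(log p / nS)`, the second-order term
of the rate (`sq_le_of_basic_inequalities`). -/

/-! ### Maurey's empirical method for quadratic forms -/

/-- Derandomized empirical approximation: if `x = ∑ q j • ξ j` is a convex combination, some sum of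
`m` of the points `ξ j` has at most the value of the quadratic form that random sampling gives. -/
lemma exists_bilin_sum_le {E ι : Type*} [AddCommGroup E] [Module ℝ E] [Fintype ι]
    (B : E →ₗ[ℝ] E →ₗ[ℝ] ℝ) (q : ι → ℝ) (hq : ∀ j, 0 ≤ q j) (hq1 : ∑ j, q j = 1) (ξ : ι → E)
    (x : E) (hx : ∑ j, q j • ξ j = x) (m : ℕ) :
    ∀ z : E, ∃ ω : Fin m → ι, B (z + ∑ i, ξ (ω i)) (z + ∑ i, ξ (ω i)) ≤
      B (z + (m : ℝ) • x) (z + (m : ℝ) • x) + m * (∑ j, q j * B (ξ j) (ξ j) - B x x) := by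
  induction m with
  | zero => intro z; exact ⟨Fin.elim0, by simp⟩
  | succ m ih =>
    intro z
    set u : E := z + (m : ℝ) • x
    -- The mixed terms are linear in `ξ j`, so averaging turns them into those of `x`; only the
    -- diagonal term changes. `B` may be indefinite, as it is in the application.
    have key : ∑ j, q j * B (u + ξ j) (u + ξ j) =
        B (u + x) (u + x) + (∑ j, q j * B (ξ j) (ξ j) - B x x) := by
      have h1 : ∑ j, q j * B u (ξ j) = B u x := by
        rw [← hx]; simp [map_sum]
      have h2 : ∑ j, q j * B (ξ j) u = B x u := by
        rw [← hx]; simp [map_sum, LinearMap.sum_apply]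
      calc ∑ j, q j * B (u + ξ j) (u + ξ j)
          = ∑ j, (q j * B u u + q j * B u (ξ j) + q j * B (ξ j) u + q j * B (ξ j) (ξ j)) := by
            refine Finset.sum_congr rfl fun j _ => ?_
            simp only [map_add, LinearMap.add_apply]; ring
        _ = _ := by
            simp only [Finset.sum_add_distrib, ← Finset.sum_mul, hq1, h1, h2, map_add,
              LinearMap.add_apply]
            ring
    obtain ⟨j, hj⟩ : ∃ j, B (u + ξ j) (u + ξ j) ≤
        B (u + x) (u + x) + (∑ j, q j * B (ξ j) (ξ j) - B x x) := by
      by_contra! hcon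
      rw [← key] at hcon
      set c := ∑ j, q j * B (u + ξ j) (u + ξ j) with hc
      have : ∃ j, 0 < q j := by
        by_contra! h0
        have : ∑ j, q j ≤ 0 := Finset.sum_nonpos fun j _ => h0 j
        linarith
      obtain ⟨j0, hj0⟩ := this
      have : ∑ j, q j * c < ∑ j, q j * B (u + ξ j) (u + ξ j) :=
        Finset.sum_lt_sum (fun j _ => mul_le_mul_of_nonneg_left (hcon j).le (hq j))
          ⟨j0, Finset.mem_univ _, mul_lt_mul_of_pos_left (hcon j0) hj0⟩
      rw [← Finset.sum_mul, hq1, one_mul] at this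
      exact lt_irrefl _ (this.trans_eq hc.symm)
    obtain ⟨ω, hω⟩ := ih (z + ξ j)
    refine ⟨Fin.cons j ω, ?_⟩
    have e1 : z + ∑ i, ξ ((Fin.cons j ω : Fin (m + 1) → ι) i) = z + ξ j + ∑ i, ξ (ω i) := by
      rw [Fin.sum_univ_succ]; simp [add_assoc]
    have e2 : z + ξ j + (m : ℝ) • x = u + ξ j := by simp only [u]; abel
    have e3 : z + ((m + 1 : ℕ) : ℝ) • x = u + x := by
      simp only [u, Nat.cast_succ, add_smul, one_smul]; abel
    rw [e1, e3]
    rw [e2] at hω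
    push_cast
    linarith

/-- The sum of the signed standard basis vectors selected by `ω`. -/
noncomputable def signedSum {p m : ℕ} (ω : Fin m → Fin p × Bool) : EuclideanSpace ℝ (Fin p) :=
  ∑ i, EuclideanSpace.single (ω i).1 (if (ω i).2 then (1 : ℝ) else -1)

/-- A quadratic form that is nonnegative at the sums of `m` signed basis vectors and has diagonal
entries at most `D` is bounded below by `-D ‖x‖₁² / (m - 1)`. -/
lemma bilin_ge_of_signedSum_nonneg {p m : ℕ}
    (B : EuclideanSpace ℝ (Fin p) →ₗ[ℝ] EuclideanSpace ℝ (Fin p) →ₗ[ℝ] ℝ) (D : ℝ)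
    (hD : ∀ j, B (EuclideanSpace.single j 1) (EuclideanSpace.single j 1) ≤ D)
    (hm : 0 < m)
    (hB : ∀ ω : Fin m → Fin p × Bool, 0 ≤ B (signedSum ω) (signedSum ω))
    (x : EuclideanSpace ℝ (Fin p)) :
    -(D * (∑ j, |x j|) ^ 2) ≤ ((m : ℝ) - 1) * B x x := by
  set L := ∑ j, |x j| with hL
  have hL0 : 0 ≤ L := Finset.sum_nonneg fun j _ => abs_nonneg _
  rcases hL0.eq_or_lt with h0 | hpos
  · have : x = 0 := by
      ext j
      have := (Finset.sum_eq_zero_iff_of_nonneg (fun j _ => abs_nonneg (x j))).1 h0.symm j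
        (Finset.mem_univ j)
      simpa using this
    simp [this, ← h0]
  · set sg : Fin p → ℝ := fun j => if 0 ≤ x j then (1 : ℝ) else -1
    have hsg : ∀ j, |x j| * sg j = x j := by
      intro j
      by_cases h : 0 ≤ x j
      · simp [sg, h, abs_of_nonneg h]
      · simp [sg, h, abs_of_neg (not_le.1 h)]
    have hsg2 : ∀ j, sg j * sg j = 1 := by
      intro j; by_cases h : 0 ≤ x j <;> simp [sg, h]
    have hs : ∀ (j : Fin p) (c : ℝ), EuclideanSpace.single j c = c • EuclideanSpace.single j (1 : ℝ) := by
      intro j c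
      ext l
      by_cases h : l = j <;> simp [h]
    -- `x` is the convex combination, with weights `|x j| / L`, of the vertices `L * sg j` times a
    -- basis vector of the `ℓ₁`-ball of radius `L`; sums of vertices are `L` times signed sums.
    obtain ⟨ω, hω⟩ := exists_bilin_sum_le B (fun j => |x j| / L)
      (fun j => div_nonneg (abs_nonneg _) hL0)
      (by rw [← Finset.sum_div, div_self hpos.ne'])
      (fun j => (L * sg j) • EuclideanSpace.single j (1 : ℝ)) x
      (by
        ext l
        simp only [smul_smul, WithLp.ofLp_sum, Finset.sum_apply, PiLp.smul_apply,
          PiLp.single_apply, smul_eq_mul, mul_ite, mul_one, mul_zero,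
          Finset.sum_ite_eq, Finset.mem_univ, if_true]
        rw [show |x l| / L * (L * sg l) = (L / L) * (|x l| * sg l) by ring, div_self hpos.ne',
          hsg, one_mul]) m 0
    have e1 : (0 : EuclideanSpace ℝ (Fin p)) +
        ∑ i, (L * sg (ω i)) • EuclideanSpace.single (ω i) (1 : ℝ) =
        L • signedSum (fun i => (ω i, decide (0 ≤ x (ω i)))) := by
      rw [zero_add, signedSum, Finset.smul_sum]
      refine Finset.sum_congr rfl fun i _ => ?_
      have hsi : (if decide (0 ≤ x (ω i)) then (1 : ℝ) else -1) = sg (ω i) := by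
        by_cases h : 0 ≤ x (ω i) <;> simp [sg, h]
      change _ = L • EuclideanSpace.single (ω i) (if decide (0 ≤ x (ω i)) then (1 : ℝ) else -1)
      rw [hsi, hs _ (sg (ω i)), smul_smul]
    rw [e1] at hω
    simp only [zero_add, map_smul, LinearMap.smul_apply, smul_eq_mul] at hω
    have h2 : ∑ j, |x j| / L * (L * sg j * (L * sg j *
        B (EuclideanSpace.single j 1) (EuclideanSpace.single j 1))) ≤ D * L ^ 2 := by
      have : ∀ j, |x j| / L * (L * sg j * (L * sg j *
          B (EuclideanSpace.single j 1) (EuclideanSpace.single j 1))) ≤ |x j| * (L * D) := by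
        intro j
        calc _ = (L / L) * (sg j * sg j) * |x j| * (L *
              B (EuclideanSpace.single j 1) (EuclideanSpace.single j 1)) := by ring
          _ = |x j| * (L * B (EuclideanSpace.single j 1) (EuclideanSpace.single j 1)) := by
            rw [div_self hpos.ne', hsg2]; ring
          _ ≤ _ := by gcongr; exact hD j
      calc _ ≤ ∑ j, |x j| * (L * D) := Finset.sum_le_sum fun j _ => this j
        _ = D * L ^ 2 := by rw [← Finset.sum_mul]; ring
    have h3 := hB (fun i => (ω i, decide (0 ≤ x (ω i))))
    have h4 := mul_nonneg hL0 (mul_nonneg hL0 h3)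
    have hm' : (0 : ℝ) < m := Nat.cast_pos.2 hm
    -- The sampled value is at most `m² B x x + m (D L² - B x x)`, and it is nonnegative.
    have h5 : 0 ≤ (m : ℝ) * (((m : ℝ) - 1) * B x x + D * L ^ 2) := by
      have := mul_le_mul_of_nonneg_left h2 hm'.le
      nlinarith
    have := nonneg_of_mul_nonneg_right h5 hm'
    linarith

/-! ### Tails of sums of squares of sub-Gaussian variables -/

/-- For a standard Gaussian `g`, the expectation of `exp (g² / 4)` is at most `2`. -/
lemma lintegral_exp_sq_div_four_gaussianReal_le :
    ∫⁻ g, ENNReal.ofReal (Real.exp (g ^ 2 / 4)) ∂gaussianReal 0 1 ≤ 2 := by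
  have e : ∀ g : ℝ, gaussianPDF 0 1 g * ENNReal.ofReal (Real.exp (g ^ 2 / 4)) =
      ENNReal.ofReal ((√(2 * Real.pi))⁻¹ * Real.exp (-(1 / 4) * g ^ 2)) := by
    intro g
    rw [gaussianPDF, gaussianPDFReal, ← ENNReal.ofReal_mul (by positivity), mul_assoc,
      ← Real.exp_add]
    simp only [NNReal.coe_one, mul_one, sub_zero]
    congr 3
    ring
  rw [gaussianReal_of_var_ne_zero 0 one_ne_zero,
    lintegral_withDensity_eq_lintegral_mul _ (measurable_gaussianPDF _ _) (by fun_prop)]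
  simp only [Pi.mul_apply, e]
  rw [← ofReal_integral_eq_lintegral_ofReal
    ((integrable_exp_neg_mul_sq (by norm_num)).const_mul _) (ae_of_all _ fun g => by positivity),
    integral_const_mul, integral_gaussian]
  have : (√(2 * Real.pi))⁻¹ * √(Real.pi / (1 / 4)) ≤ 2 := by
    rw [← Real.sqrt_inv, ← Real.sqrt_mul (by positivity)]
    apply Real.sqrt_le_iff.2 ⟨by norm_num, ?_⟩
    field_simp
    norm_num
  calc _ ≤ ENNReal.ofReal 2 := ENNReal.ofReal_le_ofReal this
    _ = 2 := by simp

section SubGaussian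

variable {Ω : Type*} [MeasurableSpace Ω] {μ : Measure Ω}

/-- Gaussian linearization: `exp (Z² / (4κ))` is the mean of `exp (s Z g)` over a standard Gaussian
`g` with `s² = 1 / (2κ)`. By Tonelli, integrating over `Z` first leaves at most the mean of `exp (g²
/ 4)`. -/
lemma lintegral_exp_sq_le_of_hasSubgaussianMGF [SFinite μ] {Z : Ω → ℝ} {κ : ℝ≥0} (hκ : 0 < κ)
    (hZm : Measurable Z) (hZ : HasSubgaussianMGF Z κ μ) :
    ∫⁻ ω, ENNReal.ofReal (Real.exp (1 / (4 * κ) * Z ω ^ 2)) ∂μ ≤ 2 := by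
  have hκ' : (0 : ℝ) < κ := by exact_mod_cast hκ
  set s : ℝ := √(1 / (2 * κ)) with hs
  have hs2 : s ^ 2 = 1 / (2 * κ) := Real.sq_sqrt (by positivity)
  have h1 : ∀ ω, ENNReal.ofReal (Real.exp (1 / (4 * κ) * Z ω ^ 2)) =
      ∫⁻ g, ENNReal.ofReal (Real.exp (s * Z ω * g)) ∂gaussianReal 0 1 := by
    intro ω
    have h := congrFun (mgf_fun_id_gaussianReal (μ := 0) (v := 1)) (s * Z ω)
    rw [← ofReal_integral_eq_lintegral_ofReal (integrable_exp_mul_gaussianReal _)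
      (ae_of_all _ fun g => (Real.exp_pos _).le)]
    rw [mgf] at h
    rw [h]
    congr 2
    simp only [zero_mul, NNReal.coe_one, one_mul, zero_add, mul_pow, hs2]
    field_simp
    ring
  simp only [h1]
  rw [lintegral_lintegral_swap (by fun_prop)]
  refine (lintegral_mono fun g => ?_).trans lintegral_exp_sq_div_four_gaussianReal_le
  have h2 : ∀ ω, Real.exp (s * Z ω * g) = Real.exp ((s * g) * Z ω) := fun ω => by ring_nf
  simp only [h2]
  rw [← ofReal_integral_eq_lintegral_ofReal (hZ.integrable_exp_mul _)
      (ae_of_all _ fun g => (Real.exp_pos _).le)]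
  refine ENNReal.ofReal_le_ofReal ((hZ.mgf_le _).trans (Real.exp_le_exp.2 (le_of_eq ?_)))
  rw [mul_pow, hs2]
  field_simp
  ring

lemma integrable_exp_sq_of_hasSubgaussianMGF [SFinite μ] {Z : Ω → ℝ} {κ : ℝ≥0} (hκ : 0 < κ)
    (hZm : Measurable Z) (hZ : HasSubgaussianMGF Z κ μ) :
    Integrable (fun ω => Real.exp (1 / (4 * κ) * Z ω ^ 2)) μ := by
  refine ⟨by fun_prop, ?_⟩
  rw [hasFiniteIntegral_iff_ofReal (ae_of_all _ fun g => (Real.exp_pos _).le)]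
  exact (lintegral_exp_sq_le_of_hasSubgaussianMGF hκ hZm hZ).trans_lt (by simp)

lemma mgf_sq_le_of_hasSubgaussianMGF [SFinite μ] {Z : Ω → ℝ} {κ : ℝ≥0} (hκ : 0 < κ)
    (hZm : Measurable Z) (hZ : HasSubgaussianMGF Z κ μ) :
    mgf (fun ω => Z ω ^ 2) μ (1 / (4 * κ)) ≤ 2 := by
  rw [mgf, integral_eq_lintegral_of_nonneg_ae (ae_of_all _ fun g => (Real.exp_pos _).le)
    (by fun_prop)]
  exact ENNReal.toReal_le_of_le_ofReal (by norm_num)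
    ((lintegral_exp_sq_le_of_hasSubgaussianMGF hκ hZm hZ).trans (by simp))

/-- Upper tail of a sum of squares of independent sub-Gaussian variables. -/
lemma measureReal_sum_sq_ge_le [IsProbabilityMeasure μ] {n : ℕ} {Z : Fin n → Ω → ℝ} {κ : ℝ≥0}
    (hκ : 0 < κ) (hZm : ∀ i, Measurable (Z i)) (hind : iIndepFun Z μ)
    (hZ : ∀ i, HasSubgaussianMGF (Z i) κ μ) (r : ℝ) :
    μ.real {ω | 4 * κ * (n + r) ≤ ∑ i, Z i ω ^ 2} ≤ Real.exp (-r) := by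
  have hκ' : (0 : ℝ) < κ := by exact_mod_cast hκ
  have hm : ∀ i, Measurable (fun ω => Z i ω ^ 2) := fun i => (hZm i).pow_const 2
  have hind2 : iIndepFun (fun i ω => Z i ω ^ 2) μ :=
    hind.comp (fun _ x => x ^ 2) (fun _ => by fun_prop)
  have h1 := measure_ge_le_exp_mul_mgf (μ := μ) (X := ∑ i, fun ω => Z i ω ^ 2)
    (t := 1 / (4 * κ)) (4 * κ * (n + r)) (by positivity)
    (hind2.integrable_exp_mul_sum hm
      fun i _ => integrable_exp_sq_of_hasSubgaussianMGF hκ (hZm i) (hZ i))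
  rw [hind2.mgf_sum hm] at h1
  simp only [Finset.sum_apply] at h1
  refine h1.trans ?_
  -- Each factor is at most `2 ≤ e`; the resulting `exp n` cancels the `n` in the threshold.
  have h2 : ∏ i, mgf (fun ω => Z i ω ^ 2) μ (1 / (4 * κ)) ≤ Real.exp n := by
    calc _ ≤ ∏ _i : Fin n, Real.exp 1 := Finset.prod_le_prod (fun i _ => mgf_nonneg) fun i _ =>
          (mgf_sq_le_of_hasSubgaussianMGF hκ (hZm i) (hZ i)).trans
            (by have := Real.add_one_le_exp 1; linarith)
      _ = Real.exp n := by simp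
  calc _ ≤ Real.exp (-(1 / (4 * κ)) * (4 * κ * (n + r))) * Real.exp n := by gcongr
    _ = Real.exp (-r) := by
      rw [← Real.exp_add]; congr 1; field_simp; ring

lemma pow_four_le_exp_add_exp_neg (x : ℝ) : x ^ 4 ≤ 24 * (Real.exp x + Real.exp (-x)) := by
  wlog h : 0 ≤ x with H
  · have := H (-x) (by linarith)
    simp only [neg_neg] at this
    nlinarith
  have h1 := Real.pow_div_factorial_le_exp x h 4
  have h2 := Real.exp_pos (-x)
  have : ((Nat.factorial 4 : ℕ) : ℝ) = 24 := by norm_num [Nat.factorial]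
  rw [this] at h1
  linarith

lemma integrable_pow_of_hasSubgaussianMGF {Z : Ω → ℝ} {κ : ℝ≥0}
    (hZ : HasSubgaussianMGF Z κ μ) (n : ℕ) : Integrable (fun ω => Z ω ^ n) μ :=
  integrable_pow_of_mem_interior_integrableExpSet
    (by simp [HasSubgaussianMGF.integrableExpSet_eq_univ hZ]) n

lemma integral_pow_four_le_of_hasSubgaussianMGF {Z : Ω → ℝ} {κ : ℝ≥0}
    (hZ : HasSubgaussianMGF Z κ μ) : ∫ ω, Z ω ^ 4 ∂μ ≤ 48 * Real.exp (κ / 2) := by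
  have h1 := hZ.integrable_exp_mul 1
  have h2 := hZ.integrable_exp_mul (-1)
  have m1 := hZ.mgf_le 1
  have m2 := hZ.mgf_le (-1)
  simp only [mgf, one_mul, neg_one_mul, one_pow, mul_one, even_two, Even.neg_pow] at h1 h2 m1 m2
  calc ∫ ω, Z ω ^ 4 ∂μ ≤ ∫ ω, 24 * (Real.exp (Z ω) + Real.exp (-Z ω)) ∂μ :=
        integral_mono (integrable_pow_of_hasSubgaussianMGF hZ 4) ((h1.add h2).const_mul _)
          fun ω => pow_four_le_exp_add_exp_neg _
    _ = 24 * (∫ ω, Real.exp (Z ω) ∂μ + ∫ ω, Real.exp (-Z ω) ∂μ) := by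
        rw [integral_const_mul, integral_add h1 h2]
    _ ≤ _ := by linarith

/-- `(1 + y + y²/2)(1 - y + y²/2) = 1 + y⁴/4 ≥ 1`, and the first factor is at most `exp y`. -/
lemma exp_neg_le_one_sub_add_sq {y : ℝ} (hy : 0 ≤ y) : Real.exp (-y) ≤ 1 - y + y ^ 2 / 2 := by
  have h1 : 1 + y + y ^ 2 / 2 ≤ Real.exp y := Real.quadratic_le_exp_of_nonneg hy
  have h3 : 0 < 1 - y + y ^ 2 / 2 := by nlinarith [sq_nonneg (y - 1)]
  rw [Real.exp_neg]
  rw [inv_le_comm₀ (Real.exp_pos _) h3]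
  refine le_trans ?_ h1
  rw [inv_le_iff_one_le_mul₀ h3]
  nlinarith [sq_nonneg (y ^ 2)]

/-- Lower tail of a sum of squares of independent sub-Gaussian variables. -/
lemma measureReal_sum_sq_le_le [IsProbabilityMeasure μ] {n : ℕ} {Z : Fin n → Ω → ℝ} {κ : ℝ≥0}
    (hZm : ∀ i, Measurable (Z i)) (hind : iIndepFun Z μ)
    (hZ : ∀ i, HasSubgaussianMGF (Z i) κ μ) {α : ℝ} (hα : 0 < α)
    (hα2 : ∀ i, α ≤ ∫ ω, Z i ω ^ 2 ∂μ) :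
    μ.real {ω | ∑ i, Z i ω ^ 2 ≤ α / 4 * n} ≤
      Real.exp (-(α ^ 2 / (4 * (48 * Real.exp (κ / 2))) * n)) := by
  set B : ℝ := 48 * Real.exp (κ / 2) with hB
  have hB0 : 0 < B := by positivity
  -- The minimizer of `-l α + l² B / 2`. Since the summands are nonnegative, the second-order bound
  -- on `exp (-l Z²)` needs only the fourth moment of `Z`.
  set l := α / B with hl
  have hl0 : 0 < l := by positivity
  have hm : ∀ i, Measurable (fun ω => Z i ω ^ 2) := fun i => (hZm i).pow_const 2
  have hind2 : iIndepFun (fun i ω => Z i ω ^ 2) μ :=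
    hind.comp (fun _ x => x ^ 2) (fun _ => by fun_prop)
  have hint : ∀ i, Integrable (fun ω => Real.exp (-l * Z i ω ^ 2)) μ := fun i =>
    Integrable.of_bound (by fun_prop) 1 (ae_of_all _ fun ω => by
      rw [Real.norm_eq_abs, Real.abs_exp, Real.exp_le_one_iff]
      nlinarith [mul_nonneg hl0.le (sq_nonneg (Z i ω))])
  have h1 := measure_le_le_exp_mul_mgf (μ := μ) (X := ∑ i, fun ω => Z i ω ^ 2)
    (t := -l) (α / 4 * n) (by linarith)
    (hind2.integrable_exp_mul_sum hm fun i _ => hint i)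
  rw [hind2.mgf_sum hm] at h1
  simp only [Finset.sum_apply] at h1
  refine h1.trans ?_
  have h2 : ∀ i, mgf (fun ω => Z i ω ^ 2) μ (-l) ≤ Real.exp (-(l * α) + l ^ 2 * B / 2) := by
    intro i
    have i2 := integrable_pow_of_hasSubgaussianMGF (hZ i) 2
    have i4 := integrable_pow_of_hasSubgaussianMGF (hZ i) 4
    have i1 : Integrable (fun ω => 1 - l * Z i ω ^ 2) μ :=
      (integrable_const _).sub (i2.const_mul _)
    calc ∫ ω, Real.exp (-l * Z i ω ^ 2) ∂μ
        ≤ ∫ ω, ((1 - l * Z i ω ^ 2) + l ^ 2 / 2 * Z i ω ^ 4) ∂μ := by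
          refine integral_mono (hint i)
            (i1.add (i4.const_mul _)) fun ω => ?_
          have := exp_neg_le_one_sub_add_sq (mul_nonneg hl0.le (sq_nonneg (Z i ω)))
          simp only [neg_mul]
          refine this.trans (le_of_eq ?_)
          ring
      _ = (1 - l * ∫ ω, Z i ω ^ 2 ∂μ) + l ^ 2 / 2 * ∫ ω, Z i ω ^ 4 ∂μ := by
          rw [integral_add i1 (i4.const_mul _),
            integral_sub (integrable_const _) (i2.const_mul _), integral_const_mul,
            integral_const_mul]
          simp
      _ ≤ (1 - l * α) + l ^ 2 / 2 * B := by
          have := integral_pow_four_le_of_hasSubgaussianMGF (hZ i)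
          have := hα2 i
          gcongr
      _ ≤ _ := by
          have := Real.add_one_le_exp (-(l * α) + l ^ 2 * B / 2)
          linarith
  have h3 : ∏ i, mgf (fun ω => Z i ω ^ 2) μ (-l) ≤
      Real.exp (n * (-(l * α) + l ^ 2 * B / 2)) := by
    calc _ ≤ ∏ _i : Fin n, Real.exp (-(l * α) + l ^ 2 * B / 2) :=
          Finset.prod_le_prod (fun i _ => mgf_nonneg) fun i _ => h2 i
      _ = _ := by simp [← Real.exp_nat_mul]
  calc _ ≤ Real.exp (- -l * (α / 4 * n)) * Real.exp (n * (-(l * α) + l ^ 2 * B / 2)) := by gcongr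
    _ = _ := by
      rw [← Real.exp_add]; congr 1; rw [hl]; field_simp; ring

end SubGaussian

/-! ### Second moments and fixed-direction tails of the designs -/

open scoped Matrix in
-- An eigenvector of `S - α` is an eigenvector of `S` with eigenvalue larger by `α`, so all
-- eigenvalues of `S - α` are nonnegative.
lemma mul_norm_sq_le_dotProduct_of_eigenvalue_ge {p : ℕ} {S : Matrix (Fin p) (Fin p) ℝ}
    (hS : S.IsHermitian) {α : ℝ}
    (hα : ∀ ev : ℝ, Module.End.HasEigenvalue (Matrix.toLin' S) ev → α ≤ ev)
    (v : EuclideanSpace ℝ (Fin p)) : α * ‖v‖ ^ 2 ≤ v.ofLp ⬝ᵥ S *ᵥ v.ofLp := by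
  have hT : (S - α • (1 : Matrix (Fin p) (Fin p) ℝ)).IsHermitian := by
    refine hS.sub ?_
    rw [Matrix.IsHermitian, Matrix.conjTranspose_smul, Matrix.conjTranspose_one, star_trivial]
  have hpos : (S - α • (1 : Matrix (Fin p) (Fin p) ℝ)).PosSemidef := by
    rw [hT.posSemidef_iff_eigenvalues_nonneg]
    intro i
    have h1 := hT.mulVec_eigenvectorBasis i
    rw [Matrix.sub_mulVec, Matrix.smul_mulVec, Matrix.one_mulVec, sub_eq_iff_eq_add,
      ← add_smul] at h1
    have h2 : (hT.eigenvectorBasis i).ofLp ≠ 0 := by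
      intro h0
      have : hT.eigenvectorBasis i = 0 := by ext j; simp [h0]
      exact (hT.eigenvectorBasis.toBasis.ne_zero i) (by simpa using this)
    have h3 := hα (hT.eigenvalues i + α)
      (Module.End.hasEigenvalue_of_hasEigenvector (x := (hT.eigenvectorBasis i).ofLp)
        ⟨Module.End.mem_eigenspace_iff.2 (by rw [Matrix.toLin'_apply]; exact h1), h2⟩)
    simpa using h3
  have h := hpos.dotProduct_mulVec_nonneg v.ofLp
  rw [Matrix.sub_mulVec, Matrix.smul_mulVec, Matrix.one_mulVec, dotProduct_sub] at h
  rw [EuclideanSpace.real_norm_sq_eq]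
  simp only [star_trivial, dotProduct_smul, smul_eq_mul] at h
  have e : v.ofLp ⬝ᵥ v.ofLp = ∑ i, v.ofLp i ^ 2 :=
    Finset.sum_congr rfl fun i _ => by ring
  rw [e] at h
  linarith

namespace TransFusion

variable {Ω : Type u} [MeasurableSpace Ω] {μ : Measure Ω}

open scoped Matrix in
lemma integral_inner_sq_eq {p : ℕ} [IsProbabilityMeasure μ] {Z : Ω → EuclideanSpace ℝ (Fin p)}
    (hmean : ∀ j, ∫ ω, Z ω j ∂μ = 0) (hL2 : ∀ j, MemLp (fun ω => Z ω j) 2 μ)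
    (v : EuclideanSpace ℝ (Fin p)) :
    ∫ ω, inner ℝ (Z ω) v ^ 2 ∂μ = v.ofLp ⬝ᵥ covMatrix μ Z *ᵥ v.ofLp := by
  have hin : ∀ ω, inner ℝ (Z ω) v = ∑ j, Z ω j * v j := by
    intro ω
    rw [PiLp.inner_apply]
    exact Finset.sum_congr rfl fun j _ => by simp [mul_comm]
  have hL : ∀ j, MemLp (fun ω => Z ω j * v j) 2 μ := fun j => by
    simpa [mul_comm] using (hL2 j).const_mul (v j)
  have h0 : ∫ ω, inner ℝ (Z ω) v ∂μ = 0 := by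
    simp only [hin]
    rw [integral_finsetSum _ fun j _ => (hL j).integrable (by norm_num)]
    simp [integral_mul_const, hmean]
  have hm : AEMeasurable (fun ω => inner ℝ (Z ω) v) μ := by
    simp only [hin]
    exact Finset.aemeasurable_fun_sum _ fun j _ => (hL j).1.aemeasurable
  rw [← variance_of_integral_eq_zero hm h0, ← covariance_self hm]
  simp only [hin]
  rw [covariance_fun_sum_fun_sum hL hL]
  simp only [covariance_mul_const_left, covariance_mul_const_right, dotProduct, Matrix.mulVec,
    covMatrix, Matrix.of_apply, Finset.mul_sum]
  exact Finset.sum_congr rfl fun i _ => Finset.sum_congr rfl fun j _ => by ring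

variable {K p nT nS : ℕ} {c : ℝ} {κ : ℝ≥0} {S : Fin (K + 1) → Matrix (Fin p) (Fin p) ℝ}
  {X : (k : Fin (K + 1)) → Fin (sampleSize nT nS k) → Ω → EuclideanSpace ℝ (Fin p)}

lemma SubGaussianDesigns.inv_mul_norm_sq_le [IsProbabilityMeasure μ]
    (hX : SubGaussianDesigns μ c κ S X) (k : Fin (K + 1)) (i : Fin (sampleSize nT nS k))
    (v : EuclideanSpace ℝ (Fin p)) : 1 / c * ‖v‖ ^ 2 ≤ ∫ ω, inner ℝ (X k i ω) v ^ 2 ∂μ := by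
  have hL2 : ∀ j, MemLp (fun ω => X k i ω j) 2 μ := fun j => by
    have := (hX.subGaussian k i (EuclideanSpace.single j 1) (by simp)).memLp 2
    simpa [EuclideanSpace.inner_single_right] using this
  rw [integral_inner_sq_eq (hX.mean_zero k i) hL2, hX.cov_eq k i]
  refine mul_norm_sq_le_dotProduct_of_eigenvalue_ge ?_
    (fun ev hev => (hX.eigenvalue_bounds k ev hev).1) v
  rw [← hX.cov_eq k i]
  ext a b
  simp [covMatrix, covariance_comm]

lemma SubGaussianDesigns.mono (hX : SubGaussianDesigns μ c κ S X) {κ' : ℝ≥0} (h : κ ≤ κ') :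
    SubGaussianDesigns μ c κ' S X where
  measurable := hX.measurable
  indep := hX.indep
  mean_zero := hX.mean_zero
  cov_eq := hX.cov_eq
  eigenvalue_bounds := hX.eigenvalue_bounds
  subGaussian k i v hv :=
    ⟨(hX.subGaussian k i v hv).integrable_exp_mul, fun t =>
      ((hX.subGaussian k i v hv).mgf_le t).trans (by gcongr)⟩

/-- Column norms of the designs. -/
lemma SubGaussianDesigns.measureReal_column_ge_le [IsProbabilityMeasure μ]
    (hX : SubGaussianDesigns μ c κ S X) (hκ : 0 < κ) (k : Fin (K + 1)) (j : Fin p) (r : ℝ) :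
    μ.real {ω | 4 * κ * (sampleSize nT nS k + r) ≤ ∑ i, X k i ω j ^ 2} ≤ Real.exp (-r) := by
  refine measureReal_sum_sq_ge_le (Z := fun i ω => X k i ω j) hκ
    (fun i => by have := hX.measurable k i; fun_prop) ?_ (fun i => ?_) r
  · exact (hX.indep k).comp (fun _ x => x j) (fun _ => by fun_prop)
  · have := hX.subGaussian k i (EuclideanSpace.single j 1) (by simp)
    simpa [EuclideanSpace.inner_single_right] using this

/-- Lower tail of the design's quadratic form in a fixed direction. -/
lemma SubGaussianDesigns.measureReal_quadratic_lt_le [IsProbabilityMeasure μ]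
    (hX : SubGaussianDesigns μ c κ S X) (hc : 0 < c) (k : Fin (K + 1))
    (v : EuclideanSpace ℝ (Fin p)) :
    μ.real {ω | ∑ i, inner ℝ (X k i ω) v ^ 2 < 1 / (4 * c) * sampleSize nT nS k * ‖v‖ ^ 2} ≤
      Real.exp (-((1 / c) ^ 2 / (4 * (48 * Real.exp (κ / 2))) * sampleSize nT nS k)) := by
  rcases eq_or_ne v 0 with rfl | hv
  · simpa using (Real.exp_pos _).le
  have hv0 : 0 < ‖v‖ := norm_pos_iff.2 hv
  set w : EuclideanSpace ℝ (Fin p) := ‖v‖⁻¹ • v with hw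
  have hwn : ‖w‖ = 1 := by rw [hw, norm_smul, norm_inv, norm_norm, inv_mul_cancel₀ hv0.ne']
  have hvw : v = ‖v‖ • w := by rw [hw, smul_smul, mul_inv_cancel₀ hv0.ne', one_smul]
  refine le_trans (measureReal_mono ?_) (measureReal_sum_sq_le_le (α := 1 / c)
    (Z := fun i ω => inner ℝ (X k i ω) w)
    (fun i => by have := hX.measurable k i; fun_prop) ?_ (fun i => hX.subGaussian k i w hwn)
    (by positivity) (fun i => ?_))
  · intro ω hω
    simp only [Set.mem_ofPred_eq] at hω ⊢
    have : ∑ i, inner ℝ (X k i ω) v ^ 2 = ‖v‖ ^ 2 * ∑ i, inner ℝ (X k i ω) w ^ 2 := by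
      rw [Finset.mul_sum]
      refine Finset.sum_congr rfl fun i _ => ?_
      conv_lhs => rw [hvw]
      rw [inner_smul_right, mul_pow]
    rw [this, mul_comm] at hω
    have := lt_of_mul_lt_mul_right hω (by positivity)
    refine this.le.trans (le_of_eq ?_)
    field_simp
  · exact (hX.indep k).comp (fun _ x => inner ℝ x w) (fun _ => by fun_prop)
  · have := hX.inv_mul_norm_sq_le k i w
    simpa [hwn] using this

end TransFusion

/-! ### Restricted strong convexity -/

namespace TransFusion

/-- Maurey's method for the indefinite form `‖x v‖² - α ‖v‖²`. Its diagonal entries are at most the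
squared column norms. -/
lemma quadratic_ge_of_signedSum {p n m : ℕ} (x : Fin n → EuclideanSpace ℝ (Fin p)) {α D : ℝ}
    (hm : 0 < m) (hα : 0 ≤ α) (hD : ∀ j, ∑ i, x i j ^ 2 ≤ D)
    (h : ∀ ω : Fin m → Fin p × Bool,
      α * ‖signedSum ω‖ ^ 2 ≤ ∑ i, inner ℝ (x i) (signedSum ω) ^ 2)
    (v : EuclideanSpace ℝ (Fin p)) :
    ((m : ℝ) - 1) * (α * ‖v‖ ^ 2 - ∑ i, inner ℝ (x i) v ^ 2) ≤ D * l1Norm v ^ 2 := by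
  set B : EuclideanSpace ℝ (Fin p) →ₗ[ℝ] EuclideanSpace ℝ (Fin p) →ₗ[ℝ] ℝ :=
    ∑ i, (innerₗ _ (x i)).smulRight (innerₗ _ (x i)) - α • innerₗ _ with hBdef
  have hB : ∀ w, B w w = ∑ i, inner ℝ (x i) w ^ 2 - α * ‖w‖ ^ 2 := by
    intro w
    simp [hBdef, LinearMap.sum_apply, pow_two]
  have := bilin_ge_of_signedSum_nonneg B D (fun j => ?_) hm (fun ω => ?_) v
  · rw [hB] at this
    rw [l1Norm]
    linarith
  · rw [hB]
    have := hD j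
    simp only [EuclideanSpace.inner_single_right, one_mul, conj_trivial]
    nlinarith [mul_nonneg hα (sq_nonneg ‖EuclideanSpace.single j (1 : ℝ)‖)]
  · rw [hB]
    linarith [h ω]

lemma norm_le_l1Norm {p : ℕ} (v : EuclideanSpace ℝ (Fin p)) : ‖v‖ ≤ l1Norm v := by
  have h0 : 0 ≤ l1Norm v := Finset.sum_nonneg fun j _ => abs_nonneg _
  refine abs_le_of_sq_le_sq' ?_ h0 |>.2
  rw [EuclideanSpace.real_norm_sq_eq, l1Norm]
  calc ∑ i, v i ^ 2 = ∑ i, |v i| ^ 2 := by simp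
    _ ≤ _ := Finset.sum_sq_le_sq_sum_of_nonneg fun i _ => abs_nonneg _

section

variable {Ω : Type u} [MeasurableSpace Ω] {μ : Measure Ω}
variable {K p nT nS : ℕ} {c : ℝ} {κ : ℝ≥0} {S : Fin (K + 1) → Matrix (Fin p) (Fin p) ℝ}
  {X : (k : Fin (K + 1)) → Fin (sampleSize nT nS k) → Ω → EuclideanSpace ℝ (Fin p)}

/-- Exponent in the lower tail of the quadratic form of the design in a fixed direction. -/
noncomputable def lowerTailRate (c : ℝ) (κ : ℝ≥0) : ℝ :=
  (1 / c) ^ 2 / (4 * (48 * Real.exp (κ / 2)))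

lemma lowerTailRate_pos (hc : 0 < c) (κ : ℝ≥0) : 0 < lowerTailRate c κ := by
  unfold lowerTailRate; positivity

/-- Restricted strong convexity, up to a multiple of the squared `ℓ₁`-norm. -/
lemma SubGaussianDesigns.exists_restricted_eigenvalue_event [IsProbabilityMeasure μ]
    (hX : SubGaussianDesigns μ c κ S X) (hc : 0 < c) (hp : 2 ≤ p) {R : ℝ} (hR : 0 ≤ R)
    (k : Fin (K + 1)) :
    ∃ Bad : Set Ω, μ.real Bad ≤ Real.exp (-(R * Real.log p)) ∧ ∀ ω ∉ Bad,
      (∀ j, ∑ i, X k i ω j ^ 2 ≤ 4 * κ * (sampleSize nT nS k + R * Real.log p)) →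
      ∀ v, 1 / (4 * c) * sampleSize nT nS k * ‖v‖ ^ 2 ≤ ∑ i, inner ℝ (X k i ω) v ^ 2 +
        (8 * (4 * κ * (1 + lowerTailRate c κ)) / lowerTailRate c κ +
          1 / (4 * c) * ((16 + 2 * R) / lowerTailRate c κ)) * Real.log p * l1Norm v ^ 2 := by
  set γ := lowerTailRate c κ with hγ
  have hγ0 : 0 < γ := lowerTailRate_pos hc κ
  set L := Real.log p with hL
  have hp2 : (2 : ℝ) ≤ p := by exact_mod_cast hp
  have hL0 : 0 < L := Real.log_pos (by linarith)
  set n : ℝ := (sampleSize nT nS k : ℝ) with hn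
  have hn0 : 0 ≤ n := Nat.cast_nonneg _
  have hκ0 : (0 : ℝ) ≤ κ := κ.2
  -- Below this sample size the left side is dominated by the `ℓ₁` term, since `‖v‖ ≤ ‖v‖₁`; no
  -- event has to be excluded.
  rcases lt_or_ge n ((16 + 2 * R) / γ * L) with hlt | hge
  · refine ⟨∅, by simpa using (Real.exp_pos _).le, fun ω _ _ v => ?_⟩
    have h1 : 0 ≤ ∑ i, inner ℝ (X k i ω) v ^ 2 := Finset.sum_nonneg fun i _ => sq_nonneg _
    have h2 : ‖v‖ ^ 2 ≤ l1Norm v ^ 2 := by gcongr; exact norm_le_l1Norm v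
    calc 1 / (4 * c) * n * ‖v‖ ^ 2
        ≤ 1 / (4 * c) * ((16 + 2 * R) / γ * L) * l1Norm v ^ 2 := by gcongr
      _ = 0 + (0 + 1 / (4 * c) * ((16 + 2 * R) / γ)) * L * l1Norm v ^ 2 := by ring
      _ ≤ _ := by
        gcongr
        positivity
  · have hnL : (16 + 2 * R) * L ≤ γ * n := by
      have := mul_le_mul_of_nonneg_left hge hγ0.le
      calc (16 + 2 * R) * L = γ * ((16 + 2 * R) / γ * L) := by field_simp
        _ ≤ _ := this
    have hRL : 0 ≤ R * L := by positivity
    -- With this `m`, `(2p)^m ≤ exp (2 m log p) ≤ exp (γ n / 2)` uses up half of the tail exponent;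
    -- the other half is at least `R log p`. The 16 in the threshold gives `m - 1 ≥ γ n / (8 log
    -- p)`.
    set m : ℕ := ⌊γ / 4 * n / L⌋₊ with hm
    have hm1 : (m : ℝ) ≤ γ / 4 * n / L := Nat.floor_le (by positivity)
    have hm2 : γ / 4 * n / L < m + 1 := Nat.lt_floor_add_one _
    have hm3 : (m : ℝ) * L ≤ γ / 4 * n := by rwa [le_div_iff₀ hL0] at hm1
    have hm4 : γ / 4 * n < (m + 1) * L := by rwa [div_lt_iff₀ hL0] at hm2
    have hm5 : γ * n / 8 ≤ (m - 1) * L := by nlinarith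
    have hm6 : (0 : ℝ) < (m : ℝ) - 1 := by
      by_contra hcon
      push Not at hcon
      nlinarith
    have hm7 : 0 < m := by
      have : (0 : ℝ) < m := by linarith
      exact_mod_cast this
    refine ⟨⋃ ω' : Fin m → Fin p × Bool,
      {ω | ∑ i, inner ℝ (X k i ω) (signedSum ω') ^ 2 < 1 / (4 * c) * n * ‖signedSum ω'‖ ^ 2},
      ?_, ?_⟩
    · refine (measureReal_iUnion_fintype_le _).trans ?_
      refine (Finset.sum_le_sum fun ω' _ =>
        hX.measureReal_quadratic_lt_le hc k (signedSum ω')).trans ?_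
      rw [Finset.sum_const, Finset.card_univ, nsmul_eq_mul]
      have hcard : ((Fintype.card (Fin m → Fin p × Bool) : ℕ) : ℝ) =
          Real.exp (m * Real.log (p * 2)) := by
        simp only [Fintype.card_fun, Fintype.card_prod, Fintype.card_fin, Fintype.card_bool]
        push_cast
        rw [← Real.exp_log (show (0 : ℝ) < (p * 2 : ℝ) ^ m by positivity), Real.log_pow]
      rw [hcard, ← Real.exp_add, Real.exp_le_exp]
      have hlog2 : Real.log (p * 2) ≤ 2 * L := by
        rw [Real.log_mul (by positivity) (by norm_num)]
        have : Real.log 2 ≤ L := Real.log_le_log (by norm_num) hp2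
        linarith
      have h1 : (m : ℝ) * Real.log (p * 2) ≤ m * (2 * L) := by gcongr
      change (m : ℝ) * Real.log (p * 2) + -(γ * n) ≤ -(R * L)
      nlinarith
    · intro ω hω hcol v
      simp only [Set.mem_iUnion, Set.mem_ofPred_eq, not_exists, not_lt] at hω
      have h1 := quadratic_ge_of_signedSum (fun i => X k i ω) hm7
        (α := 1 / (4 * c) * n) (by positivity) hcol hω v
      have hD : 4 * κ * (n + R * L) ≤ 4 * κ * (1 + γ) * n := by
        rw [mul_assoc (4 * (κ : ℝ))]
        gcongr
        nlinarith
      have hl : 0 ≤ l1Norm v ^ 2 := sq_nonneg _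
      have h2 : ((m : ℝ) - 1) * (1 / (4 * c) * n * ‖v‖ ^ 2 - ∑ i, inner ℝ (X k i ω) v ^ 2) ≤
          ((m : ℝ) - 1) * (8 * (4 * κ * (1 + γ)) / γ * L * l1Norm v ^ 2) := by
        calc _ ≤ 4 * κ * (1 + γ) * n * l1Norm v ^ 2 := h1.trans (by gcongr)
          _ = 8 * (4 * κ * (1 + γ)) / γ * (γ * n / 8) * l1Norm v ^ 2 := by
            field_simp
          _ ≤ 8 * (4 * κ * (1 + γ)) / γ * ((m - 1) * L) * l1Norm v ^ 2 := by gcongr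
          _ = _ := by ring
      have h3 := le_of_mul_le_mul_left h2 hm6
      have h4 : 0 ≤ 1 / (4 * c) * ((16 + 2 * R) / γ) * L * l1Norm v ^ 2 := by positivity
      rw [add_mul, add_mul]
      linarith

end

/-! ### Noise with random coefficients -/

section Noise

variable {Ω : Type u} [MeasurableSpace Ω] {μ : Measure Ω}

lemma _root_.ProbabilityTheory.HasSubgaussianMGF.mono_param {Z : Ω → ℝ} {a b : ℝ≥0}
    (hZ : HasSubgaussianMGF Z a μ) (h : a ≤ b) : HasSubgaussianMGF Z b μ :=
  ⟨hZ.integrable_exp_mul, fun t => (hZ.mgf_le t).trans (by gcongr)⟩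

/-- Two-sided tail of a fixed linear combination of independent sub-Gaussian variables. -/
lemma measureReal_abs_sum_mul_ge_le {I : Type*} [Fintype I] [IsProbabilityMeasure μ]
    {e : I → Ω → ℝ} {V : ℝ≥0} (hind : iIndepFun e μ) (he : ∀ q, HasSubgaussianMGF (e q) V μ)
    (a : I → ℝ) {b : ℝ≥0} (hab : ∑ q, a q ^ 2 ≤ b) {r : ℝ} (hr : 0 ≤ r) :
    μ.real {ω | r ≤ |∑ q, a q * e q ω|} ≤ 2 * Real.exp (-r ^ 2 / (2 * (b * V))) := by
  have h1 : HasSubgaussianMGF (fun ω => ∑ q, a q * e q ω) (b * V) μ := by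
    have hq : ∀ q, HasSubgaussianMGF ((fun y => a q * y) ∘ e q) ((a q ^ 2).toNNReal * V) μ := by
      intro q
      refine HasSubgaussianMGF.mono_param ((he q).const_mul (a q)) (le_of_eq ?_)
      congr 1
      exact (Real.toNNReal_of_nonneg (sq_nonneg _)).symm
    refine (HasSubgaussianMGF.sum_of_iIndepFun
      (hind.comp (fun q y => a q * y) (fun q => by fun_prop)) (s := Finset.univ)
      fun q _ => hq q).mono_param ?_
    rw [← Finset.sum_mul]
    gcongr
    rw [← NNReal.coe_le_coe]
    push_cast
    exact (Finset.sum_congr rfl fun q _ => Real.coe_toNNReal _ (sq_nonneg _)).trans_le hab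
  have h2 := h1.neg
  have t1 := h1.measure_ge_le hr
  have t2 := h2.measure_ge_le hr
  have hsub : {ω | r ≤ |∑ q, a q * e q ω|} ⊆ {ω | r ≤ ∑ q, a q * e q ω} ∪
      {ω | r ≤ (-fun ω => ∑ q, a q * e q ω) ω} := by
    intro ω hω
    simp only [Set.mem_ofPred_eq, le_abs, Set.mem_union, Pi.neg_apply] at hω ⊢
    exact hω
  refine (measureReal_mono hsub).trans ((measureReal_union_le _ _).trans ?_)
  push_cast at t1 t2
  linarith

/-- If `ξ` and `e` are independent, a bound on the `e`-probability of every `ξ`-section bounds the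
joint probability. -/
lemma measureReal_indepFun_le {E F : Type*} [MeasurableSpace E] [MeasurableSpace F]
    [IsProbabilityMeasure μ] {ξ : Ω → E} {e : Ω → F} (hξ : Measurable ξ) (he : Measurable e)
    (h : IndepFun ξ e μ) {B : Set (E × F)} (hB : MeasurableSet B) {δ : ℝ} (hδ : 0 ≤ δ)
    (hsec : ∀ x, μ.real {ω | (x, e ω) ∈ B} ≤ δ) : μ.real {ω | (ξ ω, e ω) ∈ B} ≤ δ := by
  have h1 : μ {ω | (ξ ω, e ω) ∈ B} = (μ.map fun ω => (ξ ω, e ω)) B :=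
    (Measure.map_apply (hξ.prodMk he) hB).symm
  have hp := Measure.isProbabilityMeasure_map (μ := μ) hξ.aemeasurable
  have hp' := Measure.isProbabilityMeasure_map (μ := μ) he.aemeasurable
  rw [(indepFun_iff_map_prod_eq_prod_map_map hξ.aemeasurable he.aemeasurable).1 h,
    Measure.prod_apply hB] at h1
  rw [measureReal_def, h1]
  refine ENNReal.toReal_le_of_le_ofReal hδ ?_
  calc _ ≤ ∫⁻ _x, ENNReal.ofReal δ ∂(μ.map ξ) := by
        refine lintegral_mono fun x => ?_
        rw [Measure.map_apply he (measurable_prodMk_left hB)]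
        exact (ENNReal.le_ofReal_iff_toReal_le (measure_ne_top _ _) hδ).2 (hsec x)
    _ = _ := by simp

/-- Tail of a linear combination of independent sub-Gaussian variables with random coefficients
that are independent of them, on the event that the coefficients are small. -/
lemma measureReal_abs_sum_random_mul_ge_le {I E : Type*} [Fintype I] [MeasurableSpace E]
    [IsProbabilityMeasure μ] {ξ : Ω → E} (hξ : Measurable ξ)
    {e : I → Ω → ℝ} {V : ℝ≥0} (hem : ∀ q, Measurable (e q)) (hind : iIndepFun e μ)
    (he : ∀ q, HasSubgaussianMGF (e q) V μ) (hξe : IndepFun ξ (fun ω q => e q ω) μ)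
    (f : I → E → ℝ) (hf : ∀ q, Measurable (f q)) (b : ℝ≥0) {r : ℝ} (hr : 0 ≤ r) :
    μ.real {ω | ∑ q, f q (ξ ω) ^ 2 ≤ b ∧ r ≤ |∑ q, f q (ξ ω) * e q ω|} ≤
      2 * Real.exp (-r ^ 2 / (2 * (b * V))) := by
  -- The constraint on the coefficients is part of the set, so each section is either empty or
  -- covered by the bound for fixed coefficients.
  refine measureReal_indepFun_le (B := {z : E × (I → ℝ) | ∑ q, f q z.1 ^ 2 ≤ b ∧
    r ≤ |∑ q, f q z.1 * z.2 q|}) hξ (measurable_pi_lambda _ hem) hξe ?_ (by positivity) ?_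
  · refine MeasurableSet.inter ?_ ?_
    · exact measurableSet_le (Finset.measurable_sum _ fun q _ =>
        ((hf q).comp measurable_fst).pow_const 2) measurable_const
    · have hsum : Measurable fun z : E × (I → ℝ) => ∑ q, f q z.1 * z.2 q :=
        Finset.measurable_sum _ fun q _ => ((hf q).comp measurable_fst).mul
          ((measurable_pi_apply q).comp measurable_snd)
      exact measurableSet_le measurable_const (continuous_abs.measurable.comp hsum)
  · intro x
    by_cases hx : ∑ q, f q x ^ 2 ≤ b
    · simpa [hx] using measureReal_abs_sum_mul_ge_le hind he (fun q => f q x) hx hr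
    · simpa [hx] using (Real.exp_pos _).le

end Noise

end TransFusion

/-! ### Probability of the good event -/

namespace TransFusion

lemma sum_sampleSize (K nT nS : ℕ) :
    ∑ k : Fin (K + 1), (sampleSize nT nS k : ℝ) = totalSize K nT nS := by
  rw [Fin.sum_univ_succ]
  simp [sampleSize, totalSize, add_comm]

variable {Ω : Type u} [MeasurableSpace Ω] {μ : Measure Ω}
variable {K p nT nS : ℕ} {c : ℝ} {κ V : ℝ≥0} {S : Fin (K + 1) → Matrix (Fin p) (Fin p) ℝ}
  {X : (k : Fin (K + 1)) → Fin (sampleSize nT nS k) → Ω → EuclideanSpace ℝ (Fin p)}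
  {ε : (k : Fin (K + 1)) → Fin (sampleSize nT nS k) → Ω → ℝ}

lemma GaussianErrors.hasSubgaussianMGF (hε : GaussianErrors μ V X ε) (k : Fin (K + 1))
    (i : Fin (sampleSize nT nS k)) : HasSubgaussianMGF (ε k i) V μ := by
  obtain ⟨v, hv, hlaw⟩ := hε.gaussian k i
  refine HasSubgaussianMGF.mono_param ?_ hv
  refine ⟨fun t => ?_, fun t => ?_⟩
  · have := integrable_exp_mul_gaussianReal (μ := 0) (v := v) t
    rw [← hlaw, integrable_map_measure (by fun_prop) (hε.measurable k i).aemeasurable] at this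
    exact this
  · rw [mgf_gaussianReal hlaw]
    simp

/-- The weights `a` serve two purposes: `a = 1` gives the pooled score, and the indicator of one
task gives the score of that task. -/
lemma GaussianErrors.measureReal_noise_le [IsProbabilityMeasure μ] (hε : GaussianErrors μ V X ε)
    (hXm : ∀ k i, Measurable (X k i)) (a : Fin (K + 1) → ℝ) (j : Fin p) {b : ℝ} (hb : 0 ≤ b)
    {r : ℝ} (hr : 0 ≤ r) :
    μ.real {ω | ∑ k, ∑ i, (a k * X k i ω j) ^ 2 ≤ b ∧
      r ≤ |∑ k, ∑ i, a k * X k i ω j * ε k i ω|} ≤ 2 * Real.exp (-r ^ 2 / (2 * (b * V))) := by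
  lift b to ℝ≥0 using hb
  have := measureReal_abs_sum_random_mul_ge_le (μ := μ) (V := V)
    (I := Σ k : Fin (K + 1), Fin (sampleSize nT nS k))
    (ξ := fun ω q => X q.1 q.2 ω) (measurable_pi_lambda _ fun q => hXm q.1 q.2)
    (e := fun q ω => ε q.1 q.2 ω) (fun q => hε.measurable q.1 q.2) hε.indep
    (fun q => hε.hasSubgaussianMGF q.1 q.2) hε.indep_design
    (fun q x => a q.1 * x q j) (fun q => by fun_prop) b hr
  simpa only [Fintype.sum_sigma] using this

lemma measureReal_iUnion_le_of_le {ι : Type*} [Fintype ι] {s : ι → Set Ω} {δ : ℝ}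
    (h : ∀ i, μ.real (s i) ≤ δ) : μ.real (⋃ i, s i) ≤ Fintype.card ι * δ :=
  (measureReal_iUnion_fintype_le _).trans ((Finset.sum_le_sum fun i _ => h i).trans (by simp))

/-- The multiple of `log p ‖v‖₁²` lost in the restricted strong convexity of the designs. -/
noncomputable def curvatureLoss (c : ℝ) (κ : ℝ≥0) (R : ℝ) : ℝ :=
  8 * (4 * κ * (1 + lowerTailRate c κ)) / lowerTailRate c κ +
    1 / (4 * c) * ((16 + 2 * R) / lowerTailRate c κ)

/-- The event on which the deterministic analysis applies: restricted strong convexity for every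
task and control of the noise by the regularization parameters. -/
def GoodEvent (c₀ α ρ L : ℝ)
    (x : (k : Fin (K + 1)) → Fin (sampleSize nT nS k) → EuclideanSpace ℝ (Fin p))
    (e : (k : Fin (K + 1)) → Fin (sampleSize nT nS k) → ℝ) : Prop :=
  (∀ k v, α * sampleSize nT nS k * ‖v‖ ^ 2 ≤
    ∑ i, inner ℝ (x k i) v ^ 2 + ρ * L * l1Norm v ^ 2) ∧
  (∀ j, |∑ k, ∑ i, x k i j * e k i| ≤ c₀ / 2 * √(totalSize K nT nS * L)) ∧
  ∀ (k : Fin K) j, |∑ i, x k.succ i j * e k.succ i| ≤ c₀ / 2 * √(nS * L)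

/-- Four families of bad events (curvature, column norms, pooled score, source scores) have at most
`(K + 1) p` members each, of probability at most `2 p ^ (-(A + 2))`. Since `K ≤ p ^ A`, each family
contributes at most `2 / p`. -/
lemma exists_goodEvent [IsProbabilityMeasure μ] (hX : SubGaussianDesigns μ c κ S X)
    (hε : GaussianErrors μ V X ε) (hc : 0 < c) (hκ : 0 < κ) (hV : 0 < V) {A : ℝ} (hA : 0 ≤ A)
    (hK : 1 ≤ K) (hKA : Real.log K ≤ A * Real.log p) (hp : 2 ≤ p) (hnS : Real.log p ≤ nS) :
    ∃ Bad : Set Ω, μ.real Bad ≤ 8 * Real.exp (-Real.log p) ∧ ∀ ω ∉ Bad,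
      GoodEvent √(8 * (4 * κ * (1 + 2 * (A + 2))) * V * (A + 2)) (1 / (4 * c))
        (curvatureLoss c κ (A + 2)) (Real.log p) (fun k i => X k i ω) (fun k i => ε k i ω) := by
  have hp2 : (2 : ℝ) ≤ p := by exact_mod_cast hp
  set L := Real.log p with hL
  have hL0 : 0 < L := Real.log_pos (by linarith)
  set R := A + 2 with hRdef
  have hR : 0 ≤ R := by linarith
  have hK1 : (1 : ℝ) ≤ K := by exact_mod_cast hK
  have hκ' : (0 : ℝ) < κ := hκ
  have hV' : (0 : ℝ) < V := hV
  set δ := Real.exp (-(R * L)) with hδ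
  set N : ℝ := ((totalSize K nT nS : ℕ) : ℝ) with hN
  have hNK : K * nS ≤ N := by
    rw [hN, totalSize]; push_cast; linarith [Nat.cast_nonneg (α := ℝ) nT]
  have hN0 : 0 < N := by nlinarith
  set b : ℝ := 4 * κ * (1 + 2 * R) with hb
  have hb0 : 0 < b := by positivity
  set c₀ := √(8 * b * V * R) with hc₀
  have hc₀2 : c₀ ^ 2 = 8 * b * V * R := Real.sq_sqrt (by positivity)
  choose BadR hBadR hBadR2 using fun k => hX.exists_restricted_eigenvalue_event hc hp hR k
  -- The choice of `c₀` makes the Gaussian exponent exactly `R log p` when the squared coefficients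
  -- sum to at most `b n`.
  have hnoise : ∀ n : ℝ, 0 < n → Real.exp (-(c₀ / 2 * √(n * L)) ^ 2 / (2 * (b * n * V))) = δ := by
    intro n hn
    rw [hδ, mul_pow, Real.sq_sqrt (by positivity), div_pow, hc₀2]
    congr 1
    field_simp
    ring
  set B2 : Fin (K + 1) × Fin p → Set Ω := fun q =>
    {ω | 4 * κ * (sampleSize nT nS q.1 + R * L) ≤ ∑ i, X q.1 i ω q.2 ^ 2} with hB2
  have hB2le : ∀ q, μ.real (B2 q) ≤ δ := fun q => hX.measureReal_column_ge_le hκ q.1 q.2 (R * L)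
  set B3 : Fin p → Set Ω := fun j =>
    {ω | ∑ k, ∑ i, (1 * X k i ω j) ^ 2 ≤ b * N ∧
      c₀ / 2 * √(N * L) ≤ |∑ k, ∑ i, 1 * X k i ω j * ε k i ω|} with hB3
  have hB3le : ∀ j, μ.real (B3 j) ≤ 2 * δ := fun j => by
    refine (hε.measureReal_noise_le hX.measurable (fun _ => 1) j (b := b * N)
      (by positivity) (by positivity)).trans ?_
    rw [← hnoise N hN0]
  set B4 : Fin K × Fin p → Set Ω := fun q =>
    {ω | ∑ k, ∑ i, ((if k = q.1.succ then 1 else 0) * X k i ω q.2) ^ 2 ≤ b * nS ∧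
      c₀ / 2 * √(nS * L) ≤
        |∑ k, ∑ i, (if k = q.1.succ then 1 else 0) * X k i ω q.2 * ε k i ω|} with hB4
  have hB4le : ∀ q, μ.real (B4 q) ≤ 2 * δ := fun q => by
    refine (hε.measureReal_noise_le hX.measurable (fun k => if k = q.1.succ then 1 else 0) q.2
      (b := b * nS) (by positivity) (by positivity)).trans ?_
    rw [← hnoise nS (by linarith)]
  refine ⟨(⋃ k, BadR k) ∪ (⋃ q, B2 q) ∪ (⋃ j, B3 j) ∪ (⋃ q, B4 q), ?_, ?_⟩
  · have hKexp : (K : ℝ) ≤ Real.exp (A * L) := by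
      rw [← Real.log_le_iff_le_exp (by linarith)]; exact hKA
    have hpexp : (p : ℝ) = Real.exp L := (Real.exp_log (by linarith)).symm
    have hcomb : (K : ℝ) * p * δ ≤ Real.exp (-L) := by
      calc (K : ℝ) * p * δ ≤ Real.exp (A * L) * Real.exp L * δ := by
            rw [← hpexp]; gcongr
        _ = Real.exp (-L) := by
          rw [hδ, ← Real.exp_add, ← Real.exp_add, hRdef]; congr 1; ring
    have h1 := measureReal_iUnion_le_of_le hBadR
    have h2 := measureReal_iUnion_le_of_le hB2le
    have h3 := measureReal_iUnion_le_of_le hB3le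
    have h4 := measureReal_iUnion_le_of_le hB4le
    simp only [Fintype.card_prod, Fintype.card_fin] at h1 h2 h3 h4
    push_cast at h1 h2 h3 h4
    have hδ0 : 0 < δ := Real.exp_pos _
    have k1 : ((K : ℝ) + 1) * δ ≤ 2 * (K * p * δ) := by
      have : (K : ℝ) + 1 ≤ 2 * (K * p) := by nlinarith
      calc _ ≤ 2 * (K * p) * δ := by gcongr
        _ = _ := by ring
    have k2 : ((K : ℝ) + 1) * p * δ ≤ 2 * (K * p * δ) := by
      have : 0 < p * δ := by positivity
      nlinarith
    have k3 : (p : ℝ) * (2 * δ) ≤ 2 * (K * p * δ) := by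
      have : 0 < p * δ := by positivity
      nlinarith
    refine (measureReal_union_le _ _).trans ?_
    have u1 := measureReal_union_le (μ := μ) ((⋃ k, BadR k) ∪ (⋃ q, B2 q)) (⋃ j, B3 j)
    have u2 := measureReal_union_le (μ := μ) (⋃ k, BadR k) (⋃ q, B2 q)
    linarith
  · intro ω hω
    simp only [Set.mem_union, Set.mem_iUnion, not_or, not_exists] at hω
    obtain ⟨⟨⟨g1, g2⟩, g3⟩, g4⟩ := hω
    have g2' : ∀ k j, ∑ i, X k i ω j ^ 2 ≤ 4 * κ * (sampleSize nT nS k + R * L) := by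
      intro k j
      have := g2 (k, j)
      simp only [hB2, Set.mem_ofPred_eq, not_le] at this
      exact this.le
    refine ⟨fun k v => hBadR2 k ω (g1 k) (g2' k) v, fun j => ?_, fun k j => ?_⟩
    · have := g3 j
      simp only [hB3, Set.mem_ofPred_eq, not_and, not_le, one_mul] at this
      refine (this ?_).le
      -- The `K + 1` deviations `R log p` are absorbed into `N`, because `K log p ≤ K nS ≤ N`.
      calc ∑ k, ∑ i, X k i ω j ^ 2 ≤ ∑ k, 4 * κ * (sampleSize nT nS k + R * L) :=
            Finset.sum_le_sum fun k _ => g2' k j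
        _ = 4 * κ * (N + (K + 1) * (R * L)) := by
            rw [← Finset.mul_sum, Finset.sum_add_distrib, sum_sampleSize]
            simp [hN]
        _ ≤ 4 * κ * ((1 + 2 * R) * N) := by
            have : ((K : ℝ) + 1) * (R * L) ≤ 2 * R * N := by
              have h1 : (K : ℝ) * L ≤ N := le_trans (by gcongr) hNK
              nlinarith [mul_nonneg hR hL0.le, mul_le_mul_of_nonneg_left h1 hR]
            gcongr
            linarith
        _ = b * N := by rw [hb]; ring
    · have := g4 (k, j)
      simp only [hB4, Set.mem_ofPred_eq, not_and, not_le] at this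
      have e1 : ∑ k', ∑ i, ((if k' = k.succ then 1 else 0) * X k' i ω j) ^ 2 =
          ∑ i, X k.succ i ω j ^ 2 := by
        rw [Finset.sum_eq_single k.succ (fun k' _ hk' => by simp [hk']) (by simp)]
        simp
      have e2 : ∑ k', ∑ i, (if k' = k.succ then 1 else 0) * X k' i ω j * ε k' i ω =
          ∑ i, X k.succ i ω j * ε k.succ i ω := by
        rw [Finset.sum_eq_single k.succ (fun k' _ hk' => by simp [hk']) (by simp)]
        simp
      rw [e1, e2] at this
      refine (this ?_).le
      have hs : sampleSize nT nS k.succ = nS := by simp [sampleSize]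
      calc ∑ i, X k.succ i ω j ^ 2 ≤ 4 * κ * (nS + R * L) := by simpa [hs] using g2' k.succ j
        _ ≤ 4 * κ * ((1 + 2 * R) * nS) := by
            gcongr
            nlinarith [mul_le_mul_of_nonneg_left hnS hR, mul_nonneg hR hL0.le]
        _ = b * nS := by rw [hb]; ring

end TransFusion

/-! ### Deterministic analysis: scalar inequalities and `ℓ₁` geometry -/

namespace TransFusion

set_option maxHeartbeats 800000 in
/-- The scalar inequalities that turn the basic inequality into the rate. -/
lemma sq_le_of_basic_inequalities {q c₀ θ τ on off D H w σ α ρ K M : ℝ} (hc₀ : 0 < c₀)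
    (hθ : 0 < θ) (hτ : 0 < τ) (hα : 0 < α) (hρ : 0 ≤ ρ) (hon : 0 ≤ on) (hoff : 0 ≤ off)
    (hD : 0 ≤ D) (hH : 0 ≤ H) (hw : 0 ≤ w) (hσ : 0 ≤ σ) (hK : 1 ≤ K) (hq : 0 ≤ q)
    (hKτ : K * τ ^ 2 ≤ 1) (hMρ : 2404 * ρ ≤ α * M) (hMs : M * (σ ^ 2 * θ ^ 2) ≤ 1)
    (h1 : q / 2 ≤ c₀ * θ * τ * (3 / 2 * on - 1 / 2 * off + 8 * τ * (2 * H - 15 / 16 * D)))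
    (h2 : on ≤ σ * w + τ ^ 2 * D)
    (h3 : α * w ^ 2 ≤ 3 * q + 12 * ρ * (K * (θ ^ 2 * τ ^ 2)) * (on + off) ^ 2 +
      3 * ρ * (θ ^ 2 * τ ^ 2) * (τ * D) ^ 2) :
    w ^ 2 ≤ 2 / α * (127 * c₀ ^ 2 / α + 120 * c₀ + 44430 * ρ) *
      (σ ^ 2 * (θ ^ 2 * τ ^ 2) + (1 + K * θ * (τ ^ 2 * H)) * (τ ^ 2 * H) * θ) := by
  -- In the application `θ² = log p / nS`, `τ² = nS / N`, `σ² = s`, `H = ∑ h k`, `D` is the total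
  -- `ℓ₁`-norm of the contrast errors, `on` and `off` split `‖u 0‖₁` over the support, and `q` is
  -- the squared prediction error over `N`.
  have hτ2 : τ ^ 2 ≤ 1 := by nlinarith [sq_nonneg τ]
  have hτ1 : τ ≤ 1 := by nlinarith
  have hcθτ : 0 < c₀ * θ * τ := by positivity
  set u := τ * H with hu
  have hu0 : 0 ≤ u := by positivity
  set hb := τ * u with hhb
  have hb0 : 0 ≤ hb := by positivity
  have hbe : τ ^ 2 * H = hb := by rw [hhb, hu]; ring
  have hbu : hb ≤ u := by nlinarith
  have hσw : 0 ≤ σ * w := by positivity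
  -- Cone condition: as `q ≥ 0`, the bracket in the basic inequality is nonnegative, so `on` and `H`
  -- control `off` and `D`.
  have a0 : 0 ≤ 3 / 2 * on - 1 / 2 * off + 16 * u - 15 / 2 * (τ * D) := by
    have : 0 ≤ c₀ * θ * τ * (3 / 2 * on - 1 / 2 * off + 8 * τ * (2 * H - 15 / 16 * D)) :=
      le_trans (by positivity) h1
    have := nonneg_of_mul_nonneg_right this hcθτ
    rw [hu]; linarith
  have hτD : 0 ≤ τ * D := by positivity
  have a1 : off ≤ 3 * on + 32 * u := by linarith
  have a2 : τ * D ≤ on / 5 + 32 / 15 * u := by linarith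
  -- The coefficient `1/5` of `on` in `a2` comes from the 8 in `a_k`; being below 1, it lets `τ² D`
  -- be absorbed on the left.
  have b1 : on ≤ 5 / 4 * (σ * w) + 8 / 3 * hb := by
    have e1 : τ ^ 2 * D = τ * (τ * D) := by ring
    have e2 : τ * (τ * D) ≤ τ * (on / 5 + 32 / 15 * u) := by gcongr
    have e3 : τ * on ≤ on := by nlinarith
    have e4 : τ * (on / 5 + 32 / 15 * u) = (τ * on) / 5 + 32 / 15 * hb := by rw [hhb]; ring
    linarith
  have c1 : q ≤ c₀ * θ * (15 / 4 * (τ * (σ * w)) + 40 * hb) := by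
    have e1 : c₀ * θ * τ * (3 / 2 * on - 1 / 2 * off + 8 * τ * (2 * H - 15 / 16 * D)) ≤
        c₀ * θ * τ * (15 / 8 * (σ * w) + 20 * u) := by
      refine mul_le_mul_of_nonneg_left ?_ hcθτ.le
      have : 8 * τ * (2 * H - 15 / 16 * D) = 16 * u - 15 / 2 * (τ * D) := by rw [hu]; ring
      linarith
    have e2 : 2 * (c₀ * θ * τ * (15 / 8 * (σ * w) + 20 * u)) =
      c₀ * θ * (15 / 4 * (τ * (σ * w)) + 40 * hb) := by rw [hhb]; ring
    linarith
  have hy : (θ ^ 2 * σ ^ 2) * w ^ 2 * M ≤ w ^ 2 := by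
    have := mul_le_mul_of_nonneg_right hMs (sq_nonneg w)
    linarith
  set y := (θ ^ 2 * σ ^ 2) * w ^ 2 with hy0
  have hyn : 0 ≤ y := by positivity
  set z := K * (θ ^ 2 * hb ^ 2) with hz
  have hzn : 0 ≤ z := by positivity
  -- In the sparse part `K τ² ≤ 1` cancels the factor `K`; the contrast part keeps it in `z`, which
  -- is `vₙ hBar θ`.
  have d1 : K * (θ ^ 2 * τ ^ 2) * (on + off) ^ 2 ≤ 50 * y + 3698 * z := by
    have e1 : (on + off) ^ 2 ≤ (5 * (σ * w) + 43 * u) ^ 2 :=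
      pow_le_pow_left₀ (by positivity) (by linarith) 2
    have e2 : (5 * (σ * w) + 43 * u) ^ 2 ≤ 50 * (σ * w) ^ 2 + 3698 * u ^ 2 := by
      linarith [sq_nonneg (5 * (σ * w) - 43 * u)]
    calc K * (θ ^ 2 * τ ^ 2) * (on + off) ^ 2
        ≤ K * (θ ^ 2 * τ ^ 2) * (50 * (σ * w) ^ 2 + 3698 * u ^ 2) := by
          gcongr; exact e1.trans e2
      _ = (K * τ ^ 2) * (50 * y) + 3698 * z := by rw [hy0, hz, hhb]; ring
      _ ≤ 1 * (50 * y) + 3698 * z := by gcongr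
      _ = _ := by ring
  have d2 : θ ^ 2 * τ ^ 2 * (τ * D) ^ 2 ≤ 1 / 8 * y + 18 * z := by
    have e1 : (τ * D) ^ 2 ≤ (1 / 4 * (σ * w) + 3 * u) ^ 2 :=
      pow_le_pow_left₀ (by positivity) (by linarith) 2
    have e2 : (1 / 4 * (σ * w) + 3 * u) ^ 2 ≤ 1 / 8 * (σ * w) ^ 2 + 18 * u ^ 2 := by
      linarith [sq_nonneg (1 / 4 * (σ * w) - 3 * u)]
    calc θ ^ 2 * τ ^ 2 * (τ * D) ^ 2
        ≤ θ ^ 2 * τ ^ 2 * (1 / 8 * (σ * w) ^ 2 + 18 * u ^ 2) := by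
          gcongr; exact e1.trans e2
      _ = τ ^ 2 * (1 / 8 * y) + 18 * (1 * (θ ^ 2 * hb ^ 2)) := by rw [hy0, hhb]; ring
      _ ≤ 1 * (1 / 8 * y) + 18 * (K * (θ ^ 2 * hb ^ 2)) := by gcongr
      _ = _ := by rw [hz]; ring
  -- `601` rounds up `12 * 50 + 3 / 8`, the total coefficient of `ρ y`; `2404 = 4 * 601` makes it
  -- cost a quarter of the curvature.
  have f1 : 601 * ρ * y ≤ α / 4 * w ^ 2 := by
    have e1 := mul_le_mul_of_nonneg_right hMρ hyn
    have e2 := mul_le_mul_of_nonneg_left hy hα.le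
    linarith
  -- Young's inequality, at the cost of another quarter of the curvature.
  have f2 : 45 / 4 * (c₀ * θ * (τ * (σ * w))) ≤
      α / 4 * w ^ 2 + 127 * c₀ ^ 2 / α * (σ ^ 2 * (θ ^ 2 * τ ^ 2)) := by
    have : 0 ≤ (α / 2 * w - 45 / 4 * (c₀ * θ * τ * σ)) ^ 2 / α := by positivity
    have e : (α / 2 * w - 45 / 4 * (c₀ * θ * τ * σ)) ^ 2 / α =
        α / 4 * w ^ 2 - 45 / 4 * (c₀ * θ * (τ * (σ * w))) +
        2025 / 16 * c₀ ^ 2 / α * (σ ^ 2 * (θ ^ 2 * τ ^ 2)) := by field_simp; ring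
    have e' : 2025 / 16 * c₀ ^ 2 / α * (σ ^ 2 * (θ ^ 2 * τ ^ 2)) ≤
        127 * c₀ ^ 2 / α * (σ ^ 2 * (θ ^ 2 * τ ^ 2)) := by
      gcongr; norm_num
    linarith
  have g : α / 2 * w ^ 2 ≤ 127 * c₀ ^ 2 / α * (σ ^ 2 * (θ ^ 2 * τ ^ 2)) +
      120 * c₀ * (θ * hb) + 44430 * ρ * z := by
    have h4 : 12 * ρ * (K * (θ ^ 2 * τ ^ 2)) * (on + off) ^ 2 ≤
        12 * ρ * (50 * y + 3698 * z) := by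
      calc _ = 12 * ρ * (K * (θ ^ 2 * τ ^ 2) * (on + off) ^ 2) := by ring
        _ ≤ _ := by gcongr
    have h5 : 3 * ρ * (θ ^ 2 * τ ^ 2) * (τ * D) ^ 2 ≤ 3 * ρ * (1 / 8 * y + 18 * z) := by
      calc _ = 3 * ρ * (θ ^ 2 * τ ^ 2 * (τ * D) ^ 2) := by ring
        _ ≤ _ := by gcongr
    have h6 : 0 ≤ ρ * y := by positivity
    linarith
  set C := 127 * c₀ ^ 2 / α + 120 * c₀ + 44430 * ρ with hC
  have k1 : 0 ≤ 127 * c₀ ^ 2 / α := by positivity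
  have k2 : 0 ≤ 120 * c₀ := by positivity
  have k3 : 0 ≤ 44430 * ρ := by positivity
  have t1 : 0 ≤ σ ^ 2 * (θ ^ 2 * τ ^ 2) := by positivity
  have t2 : 0 ≤ θ * hb := by positivity
  have g2 : α / 2 * w ^ 2 ≤ C * (σ ^ 2 * (θ ^ 2 * τ ^ 2) + θ * hb + z) := by
    refine g.trans ?_
    have i1 : 127 * c₀ ^ 2 / α * (σ ^ 2 * (θ ^ 2 * τ ^ 2)) ≤ C * (σ ^ 2 * (θ ^ 2 * τ ^ 2)) := by
      gcongr; linarith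
    have i2 : 120 * c₀ * (θ * hb) ≤ C * (θ * hb) := by gcongr; linarith
    have i3 : 44430 * ρ * z ≤ C * z := by gcongr; linarith
    linarith
  rw [hbe]
  calc w ^ 2 = 2 / α * (α / 2 * w ^ 2) := by field_simp
    _ ≤ 2 / α * (C * (σ ^ 2 * (θ ^ 2 * τ ^ 2) + θ * hb + z)) := by gcongr
    _ = _ := by rw [hz]; ring

variable {K p nT nS : ℕ}

lemma l1Norm_nonneg (v : EuclideanSpace ℝ (Fin p)) : 0 ≤ l1Norm v :=
  Finset.sum_nonneg fun _ _ => abs_nonneg _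

lemma l1Norm_sub_comm (v w : EuclideanSpace ℝ (Fin p)) : l1Norm (v - w) = l1Norm (w - v) :=
  Finset.sum_congr rfl fun j _ => by simp [abs_sub_comm]

lemma l1Norm_add_le (v w : EuclideanSpace ℝ (Fin p)) :
    l1Norm (v + w) ≤ l1Norm v + l1Norm w := by
  simp only [l1Norm, ← Finset.sum_add_distrib]
  exact Finset.sum_le_sum fun j _ => abs_add_le _ _

lemma objective_response (lam : ℝ) (a : Fin K → ℝ)
    (x : (k : Fin (K + 1)) → Fin (sampleSize nT nS k) → EuclideanSpace ℝ (Fin p))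
    (e : (k : Fin (K + 1)) → Fin (sampleSize nT nS k) → ℝ)
    (β b : Fin (K + 1) → EuclideanSpace ℝ (Fin p)) :
    objective lam a x (response β x e) b =
      1 / (2 * (totalSize K nT nS : ℝ)) * (∑ k, ∑ i, e k i ^ 2 -
        2 * ∑ k, ∑ i, e k i * inner ℝ (x k i) (b k - β k) +
        ∑ k, ∑ i, inner ℝ (x k i) (b k - β k) ^ 2) +
      lam * (l1Norm (b 0) + ∑ k : Fin K, a k * l1Norm (b k.succ - b 0)) := by
  simp only [objective, response, Finset.mul_sum, ← Finset.sum_sub_distrib,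
    ← Finset.sum_add_distrib]
  congr 1
  refine Finset.sum_congr rfl fun k _ => Finset.sum_congr rfl fun i _ => ?_
  rw [inner_sub_right]
  ring

lemma sum_mul_inner_eq {n : ℕ} (x : Fin n → EuclideanSpace ℝ (Fin p)) (e : Fin n → ℝ)
    (v : EuclideanSpace ℝ (Fin p)) :
    ∑ i, e i * inner ℝ (x i) v = ∑ j, (∑ i, x i j * e i) * v j := by
  simp only [PiLp.inner_apply, Finset.mul_sum, Finset.sum_mul]
  rw [Finset.sum_comm]
  exact Finset.sum_congr rfl fun j _ => Finset.sum_congr rfl fun i _ => by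
    simp; ring

lemma sum_mul_le_mul_l1Norm {g : Fin p → ℝ} {G : ℝ} (hg : ∀ j, |g j| ≤ G)
    (v : EuclideanSpace ℝ (Fin p)) : ∑ j, g j * v j ≤ G * l1Norm v := by
  rw [l1Norm, Finset.mul_sum]
  refine Finset.sum_le_sum fun j _ => (le_abs_self _).trans ?_
  rw [abs_mul]
  exact mul_le_mul_of_nonneg_right (hg j) (abs_nonneg _)

/-- Control of the noise term by `ℓ∞`-`ℓ₁` duality. -/
lemma noise_le {G₀ G₁ : ℝ}
    {x : (k : Fin (K + 1)) → Fin (sampleSize nT nS k) → EuclideanSpace ℝ (Fin p)}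
    {e : (k : Fin (K + 1)) → Fin (sampleSize nT nS k) → ℝ}
    (h0 : ∀ j, |∑ k, ∑ i, x k i j * e k i| ≤ G₀)
    (h1 : ∀ (k : Fin K) j, |∑ i, x k.succ i j * e k.succ i| ≤ G₁)
    (u : Fin (K + 1) → EuclideanSpace ℝ (Fin p)) :
    ∑ k, ∑ i, e k i * inner ℝ (x k i) (u k) ≤
      G₀ * l1Norm (u 0) + G₁ * ∑ k : Fin K, l1Norm (u k.succ - u 0) := by
  have e1 : ∑ k, ∑ i, e k i * inner ℝ (x k i) (u k) =
      ∑ j, (∑ k, ∑ i, x k i j * e k i) * u 0 j +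
        ∑ k : Fin K, ∑ j, (∑ i, x k.succ i j * e k.succ i) * (u k.succ - u 0) j := by
    have : ∀ k, ∑ i, e k i * inner ℝ (x k i) (u k) =
        ∑ j, (∑ i, x k i j * e k i) * u 0 j + ∑ j, (∑ i, x k i j * e k i) * (u k - u 0) j := by
      intro k
      rw [sum_mul_inner_eq, ← Finset.sum_add_distrib]
      exact Finset.sum_congr rfl fun j _ => by simp; ring
    simp only [this, Finset.sum_add_distrib]
    congr 1
    · rw [Finset.sum_comm]
      simp only [Finset.sum_mul]
    · rw [Fin.sum_univ_succ]
      simp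
  rw [e1, Finset.mul_sum]
  exact add_le_add (sum_mul_le_mul_l1Norm h0 _)
    (Finset.sum_le_sum fun k _ => sum_mul_le_mul_l1Norm (h1 k) _)

/-- Decomposability of the `ℓ₁`-norm over the support of `v`. -/
lemma l1Norm_sub_l1Norm_le {T : Finset (Fin p)} {v : EuclideanSpace ℝ (Fin p)}
    (hT : ∀ j ∉ T, v j = 0) (w : EuclideanSpace ℝ (Fin p)) :
    l1Norm v - l1Norm w ≤ ∑ j ∈ T, |(w - v) j| - ∑ j ∈ Tᶜ, |(w - v) j| := by
  rw [l1Norm, l1Norm, ← Finset.sum_add_sum_compl T, ← Finset.sum_add_sum_compl T (fun j => |w j|)]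
  have h1 : ∑ j ∈ T, |v j| - ∑ j ∈ T, |w j| ≤ ∑ j ∈ T, |(w - v) j| := by
    rw [← Finset.sum_sub_distrib]
    refine Finset.sum_le_sum fun j _ => ?_
    rw [PiLp.sub_apply, abs_sub_comm]
    exact abs_sub_abs_le_abs_sub _ _
  have h2 : ∑ j ∈ Tᶜ, |v j| - ∑ j ∈ Tᶜ, |w j| = - ∑ j ∈ Tᶜ, |(w - v) j| := by
    rw [← Finset.sum_sub_distrib, ← Finset.sum_neg_distrib]
    refine Finset.sum_congr rfl fun j hj => ?_
    have := hT j (by simpa using hj)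
    simp [this]
  linarith

lemma sum_abs_le_sqrt_card_mul_norm {T : Finset (Fin p)} {s : ℕ} (hT : T.card ≤ s)
    (v : EuclideanSpace ℝ (Fin p)) : ∑ j ∈ T, |v j| ≤ √s * ‖v‖ := by
  refine abs_le_of_sq_le_sq' ?_ (by positivity) |>.2
  rw [mul_pow, Real.sq_sqrt (Nat.cast_nonneg _), EuclideanSpace.real_norm_sq_eq]
  calc (∑ j ∈ T, |v j|) ^ 2 ≤ T.card * ∑ j ∈ T, |v j| ^ 2 := sq_sum_le_card_mul_sum_sq
    _ ≤ s * ∑ j, v j ^ 2 := by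
      simp only [sq_abs]
      gcongr
      exact Finset.subset_univ _

lemma average_sub_average (b β : Fin (K + 1) → EuclideanSpace ℝ (Fin p)) :
    average nT nS b - average nT nS β = average nT nS (fun k => b k - β k) := by
  simp only [average, Finset.sum_sub_distrib, smul_sub]
  abel

/-- The weights `nS / N`, taken `K` times, and `nT / N` add up to one. -/
lemma average_eq (hN : (0 : ℝ) < totalSize K nT nS)
    (u : Fin (K + 1) → EuclideanSpace ℝ (Fin p)) :
    average nT nS u = u 0 + averageContrast nT nS u := by
  have h : (K : ℝ) * nS + nT = totalSize K nT nS := by simp [totalSize]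
  simp only [average, averageContrast, Finset.sum_sub_distrib, smul_sub, Finset.sum_const,
    Finset.card_univ, Fintype.card_fin]
  have : u 0 = ((nT : ℝ) / totalSize K nT nS) • u 0 +
      ((nS : ℝ) / totalSize K nT nS) • K • u 0 := by
    rw [← Nat.cast_smul_eq_nsmul ℝ, smul_smul, ← add_smul]
    conv_lhs => rw [← one_smul ℝ (u 0)]
    congr 1
    field_simp
    linarith
  rw [add_sub, eq_sub_iff_add_eq, add_assoc, ← this, add_comm]

end TransFusion

/-! ### Basic inequality, pooled curvature and deterministic rate -/

namespace TransFusion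

variable {K p nT nS : ℕ}

/-- The basic inequality of a minimizer under control of the noise. -/
lemma quadratic_le_of_mem_argminSet {lam a G₀ G₁ : ℝ} {s : ℕ} {h : Fin K → ℝ}
    {x : (k : Fin (K + 1)) → Fin (sampleSize nT nS k) → EuclideanSpace ℝ (Fin p)}
    {e : (k : Fin (K + 1)) → Fin (sampleSize nT nS k) → ℝ}
    {β b : Fin (K + 1) → EuclideanSpace ℝ (Fin p)} (hlam : 0 ≤ lam) (ha : 0 ≤ a)
    (hN : (0 : ℝ) < totalSize K nT nS) (hβ : β ∈ paramSpace s h)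
    (h0 : ∀ j, |∑ k, ∑ i, x k i j * e k i| ≤ totalSize K nT nS * G₀)
    (h1 : ∀ (k : Fin K) j, |∑ i, x k.succ i j * e k.succ i| ≤ totalSize K nT nS * G₁)
    {T : Finset (Fin p)} (hT : ∀ j ∉ T, β 0 j = 0)
    (hb : b ∈ argminSet lam (fun _ => a) x (response β x e)) :
    (∑ k, ∑ i, inner ℝ (x k i) (b k - β k) ^ 2) / totalSize K nT nS / 2 ≤
      G₀ * l1Norm (b 0 - β 0) + G₁ * ∑ k : Fin K, l1Norm (b k.succ - β k.succ - (b 0 - β 0)) +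
      lam * (∑ j ∈ T, |(b 0 - β 0) j| - ∑ j ∈ Tᶜ, |(b 0 - β 0) j|) +
      lam * (a * (2 * ∑ k, h k -
        ∑ k : Fin K, l1Norm (b k.succ - β k.succ - (b 0 - β 0)))) := by
  have hmin := hb β
  rw [objective_response, objective_response] at hmin
  simp only [sub_self, inner_zero_right, mul_zero, Finset.sum_const_zero, sub_zero, ne_eq,
    OfNat.ofNat_ne_zero, not_false_eq_true, zero_pow, add_zero, ← Finset.mul_sum] at hmin
  have hnoise := noise_le h0 h1 (fun k => b k - β k)
  have hdec := l1Norm_sub_l1Norm_le hT (b 0)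
  -- The contrasts are small rather than sparse, so the triangle inequality is used twice, at a cost
  -- of `2 h k`.
  have hcon : ∑ k : Fin K, l1Norm (β k.succ - β 0) - ∑ k : Fin K, l1Norm (b k.succ - b 0) ≤
      2 * ∑ k, h k - ∑ k : Fin K, l1Norm (b k.succ - β k.succ - (b 0 - β 0)) := by
    rw [Finset.mul_sum, ← Finset.sum_sub_distrib, ← Finset.sum_sub_distrib]
    refine Finset.sum_le_sum fun k _ => ?_
    have e1 := l1Norm_add_le (b k.succ - b 0) (β 0 - β k.succ)
    have e2 := hβ.2 k
    have e3 : b k.succ - b 0 + (β 0 - β k.succ) = b k.succ - β k.succ - (b 0 - β 0) := by abel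
    rw [e3, l1Norm_sub_comm (β 0)] at e1
    linarith
  set N : ℝ := ((totalSize K nT nS : ℕ) : ℝ) with hNdef
  set Q := ∑ k, ∑ i, inner ℝ (x k i) (b k - β k) ^ 2
  set E := ∑ k, ∑ i, e k i * inner ℝ (x k i) (b k - β k)
  set E2 := ∑ k, ∑ i, e k i ^ 2
  have f1 : 1 / (2 * N) * (E2 - 2 * E + Q) - 1 / (2 * N) * E2 = Q / N / 2 - E / N := by
    field_simp; ring
  have f2 : E / N ≤ G₀ * l1Norm (b 0 - β 0) +
      G₁ * ∑ k : Fin K, l1Norm (b k.succ - β k.succ - (b 0 - β 0)) := by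
    rw [div_le_iff₀ hN]
    refine hnoise.trans (le_of_eq ?_)
    ring
  have f3 := mul_le_mul_of_nonneg_left hdec hlam
  have f4 := mul_le_mul_of_nonneg_left (mul_le_mul_of_nonneg_left hcon ha) hlam
  linarith

lemma l1Norm_averageContrast_le (u : Fin (K + 1) → EuclideanSpace ℝ (Fin p)) :
    l1Norm (averageContrast nT nS u) ≤
      (nS : ℝ) / totalSize K nT nS * ∑ k : Fin K, l1Norm (u k.succ - u 0) := by
  simp only [l1Norm, averageContrast, PiLp.smul_apply, WithLp.ofLp_sum, Finset.sum_apply,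
    smul_eq_mul, abs_mul]
  rw [Finset.sum_comm, ← Finset.mul_sum, abs_of_nonneg (by positivity)]
  gcongr
  exact Finset.abs_sum_le_sum_abs _ _

/-- Cauchy–Schwarz on the support is applied to the average, the vector that pooled curvature
controls, instead of `u 0`; the price is the `ℓ₁`-norm of the average contrast. -/
lemma sum_abs_le_norm_average {s : ℕ} {T : Finset (Fin p)} (hT : T.card ≤ s)
    (hN : (0 : ℝ) < totalSize K nT nS) (u : Fin (K + 1) → EuclideanSpace ℝ (Fin p)) :
    ∑ j ∈ T, |u 0 j| ≤ √s * ‖average nT nS u‖ +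
      (nS : ℝ) / totalSize K nT nS * ∑ k : Fin K, l1Norm (u k.succ - u 0) := by
  have h1 := sum_abs_le_sqrt_card_mul_norm hT (average nT nS u)
  have h2 := l1Norm_averageContrast_le (nT := nT) (nS := nS) u
  have h3 : ∑ j ∈ T, |averageContrast nT nS u j| ≤ l1Norm (averageContrast nT nS u) :=
    Finset.sum_le_sum_of_subset_of_nonneg (Finset.subset_univ _) fun _ _ _ => abs_nonneg _
  have h4 : ∑ j ∈ T, |u 0 j| ≤
      ∑ j ∈ T, |average nT nS u j| + ∑ j ∈ T, |averageContrast nT nS u j| := by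
    rw [← Finset.sum_add_distrib]
    refine Finset.sum_le_sum fun j _ => ?_
    rw [average_eq hN, PiLp.add_apply]
    exact (le_of_eq (by ring_nf)).trans (abs_sub (u 0 j + averageContrast nT nS u j) _)
  linarith

/-- Restricted strong convexity of every task bounds the average of the task vectors. -/
lemma norm_average_sq_le {α r : ℝ} (hα : 0 < α) (hr : 0 ≤ r) (hK : 1 ≤ K)
    (hN : (0 : ℝ) < totalSize K nT nS) (u : Fin (K + 1) → EuclideanSpace ℝ (Fin p))
    (q : Fin (K + 1) → ℝ) (hq : ∀ k, 0 ≤ q k)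
    (h : ∀ k, α * sampleSize nT nS k * ‖u k‖ ^ 2 ≤ q k + r * l1Norm (u k) ^ 2) :
    α * ‖average nT nS u‖ ^ 2 ≤ 3 * ((∑ k, q k) / totalSize K nT nS) +
      12 * (K * (r / totalSize K nT nS)) * l1Norm (u 0) ^ 2 +
      3 * (r / totalSize K nT nS) * ((nS : ℝ) / totalSize K nT nS *
        (∑ k : Fin K, l1Norm (u k.succ - u 0)) ^ 2) := by
  have hK1 : (1 : ℝ) ≤ K := by exact_mod_cast hK
  have hNe : (totalSize K nT nS : ℝ) = K * nS + nT := by simp [totalSize]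
  have hnS : (0 : ℝ) ≤ nS := Nat.cast_nonneg _
  have hnT : (0 : ℝ) ≤ nT := Nat.cast_nonneg _
  set N : ℝ := ((totalSize K nT nS : ℕ) : ℝ) with hNdef
  set D := ∑ k : Fin K, l1Norm (u k.succ - u 0) with hD
  have hD0 : 0 ≤ D := Finset.sum_nonneg fun _ _ => l1Norm_nonneg _
  have hl0 := l1Norm_nonneg (u 0)
  set n : Fin (K + 1) → ℝ := fun k => sampleSize nT nS k with hn
  have hn0 : ∀ k, 0 ≤ n k := fun k => Nat.cast_nonneg _
  have hw : N * ‖average nT nS u‖ ≤ ∑ k, n k * ‖u k‖ := by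
    have : ‖average nT nS u‖ ≤ nS / N * ∑ k : Fin K, ‖u k.succ‖ + nT / N * ‖u 0‖ := by
      refine (norm_add_le _ _).trans ?_
      rw [norm_smul, norm_smul, Real.norm_of_nonneg (by positivity),
        Real.norm_of_nonneg (by positivity)]
      gcongr
      exact norm_sum_le _ _
    calc _ ≤ N * (nS / N * ∑ k : Fin K, ‖u k.succ‖ + nT / N * ‖u 0‖) := by gcongr
      _ = nT * ‖u 0‖ + nS * ∑ k : Fin K, ‖u k.succ‖ := by field_simp; ring
      _ = _ := by
        rw [Fin.sum_univ_succ, Finset.mul_sum]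
        simp [hn, sampleSize]
  have hk : ∀ k, √α * (n k * ‖u k‖) ≤ √(n k) * √(q k) + √r * (√(n k) * l1Norm (u k)) := by
    intro k
    have h1 : √α * √(n k) * ‖u k‖ ≤ √(q k) + √r * l1Norm (u k) := by
      refine abs_le_of_sq_le_sq' ?_ (by have := l1Norm_nonneg (u k); positivity) |>.2
      have e1 : (√α * √(n k) * ‖u k‖) ^ 2 = α * n k * ‖u k‖ ^ 2 := by
        rw [mul_pow, mul_pow, Real.sq_sqrt hα.le, Real.sq_sqrt (hn0 k)]
      have e2 : (√(q k) + √r * l1Norm (u k)) ^ 2 = q k + r * l1Norm (u k) ^ 2 +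
          2 * (√(q k) * (√r * l1Norm (u k))) := by
        rw [add_sq, mul_pow, Real.sq_sqrt (hq k), Real.sq_sqrt hr]; ring
      rw [e1, e2]
      have : 0 ≤ √(q k) * (√r * l1Norm (u k)) := by
        have := l1Norm_nonneg (u k); positivity
      linarith [h k]
    calc √α * (n k * ‖u k‖) = √(n k) * (√α * √(n k) * ‖u k‖) := by
          nth_rewrite 1 [← Real.mul_self_sqrt (hn0 k)]; ring
      _ ≤ √(n k) * (√(q k) + √r * l1Norm (u k)) := by gcongr
      _ = _ := by ring
  -- Cauchy–Schwarz with weights `√(n k)`: the average sees the pooled error `∑ q k` with the full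
  -- sample size `N`.
  set F := ∑ k, √(n k) * √(q k) with hF
  have hF0 : 0 ≤ F := Finset.sum_nonneg fun _ _ => by positivity
  have hF2 : F ^ 2 ≤ N * ∑ k, q k := by
    refine (Finset.sum_mul_sq_le_sq_mul_sq _ _ _).trans (le_of_eq ?_)
    simp only [Real.sq_sqrt (hn0 _), Real.sq_sqrt (hq _)]
    rw [hn, sum_sampleSize]
  have hG : ∑ k, √(n k) * l1Norm (u k) ≤ (√nT + K * √nS) * l1Norm (u 0) + √nS * D := by
    rw [Fin.sum_univ_succ]
    have e0 : n 0 = nT := by simp [hn, sampleSize]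
    have e1 : ∀ k : Fin K, n k.succ = nS := fun k => by simp [hn, sampleSize]
    simp only [e0, e1, ← Finset.mul_sum]
    have : ∑ k : Fin K, l1Norm (u k.succ) ≤ K * l1Norm (u 0) + D := by
      calc ∑ k : Fin K, l1Norm (u k.succ)
          ≤ ∑ k : Fin K, (l1Norm (u 0) + l1Norm (u k.succ - u 0)) :=
            Finset.sum_le_sum fun k _ => by
              simpa using l1Norm_add_le (u 0) (u k.succ - u 0)
        _ = _ := by rw [Finset.sum_add_distrib]; simp [hD]
    have := mul_le_mul_of_nonneg_left this (Real.sqrt_nonneg (nS : ℝ))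
    linarith
  -- The factor `K` is the cost of pooling: every task loses curvature in terms of the same `‖u
  -- 0‖₁`.
  have hG2 : (√nT + K * √nS) ^ 2 ≤ 4 * K * N := by
    have e1 : (√nT + K * √nS) ^ 2 ≤ 2 * ((√nT) ^ 2 + (K * √nS) ^ 2) := add_sq_le
    rw [mul_pow, Real.sq_sqrt hnT, Real.sq_sqrt hnS] at e1
    nlinarith [mul_nonneg (sub_nonneg.2 hK1) hnT, mul_nonneg (sub_nonneg.2 hK1) hnS,
      mul_nonneg (Nat.cast_nonneg (α := ℝ) K) (mul_nonneg (sub_nonneg.2 hK1) hnS),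
      mul_nonneg (Nat.cast_nonneg (α := ℝ) K) hnT]
  set g := √nT + K * √nS with hg
  have hg0 : 0 ≤ g := by positivity
  have htot : √α * (N * ‖average nT nS u‖) ≤
      F + √r * (g * l1Norm (u 0)) + √r * (√nS * D) := by
    calc √α * (N * ‖average nT nS u‖) ≤ √α * ∑ k, n k * ‖u k‖ := by gcongr
      _ ≤ F + √r * ∑ k, √(n k) * l1Norm (u k) := by
        rw [hF, Finset.mul_sum, Finset.mul_sum, ← Finset.sum_add_distrib]
        exact Finset.sum_le_sum fun k _ => hk k
      _ ≤ F + √r * (g * l1Norm (u 0) + √nS * D) := by gcongr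
      _ = _ := by ring
  have hsq : α * (N ^ 2 * ‖average nT nS u‖ ^ 2) ≤
      3 * (N * ∑ k, q k) + 3 * (r * (4 * K * N * l1Norm (u 0) ^ 2)) + 3 * (r * (nS * D ^ 2)) := by
    have h3 : ∀ a b c : ℝ, (a + b + c) ^ 2 ≤ 3 * a ^ 2 + 3 * b ^ 2 + 3 * c ^ 2 := fun a b c => by
      linarith [sq_nonneg (a - b), sq_nonneg (a - c), sq_nonneg (b - c)]
    calc α * (N ^ 2 * ‖average nT nS u‖ ^ 2) = (√α * (N * ‖average nT nS u‖)) ^ 2 := by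
          rw [mul_pow, mul_pow, Real.sq_sqrt hα.le]
      _ ≤ (F + √r * (g * l1Norm (u 0)) + √r * (√nS * D)) ^ 2 := by gcongr
      _ ≤ _ := h3 _ _ _
      _ = 3 * F ^ 2 + 3 * (r * (g ^ 2 * l1Norm (u 0) ^ 2)) + 3 * (r * (nS * D ^ 2)) := by
          simp only [mul_pow, Real.sq_sqrt hr, Real.sq_sqrt hnS]
      _ ≤ _ := by gcongr
  have hN2 : 0 < N ^ 2 := by positivity
  refine le_of_mul_le_mul_left ?_ hN2
  calc N ^ 2 * (α * ‖average nT nS u‖ ^ 2) = α * (N ^ 2 * ‖average nT nS u‖ ^ 2) := by ring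
    _ ≤ _ := hsq
    _ = _ := by field_simp; ring

/-- The rate of the averaged co-training estimator on the good event. -/
lemma norm_average_sub_sq_le {c₀ α ρ L M : ℝ} {s : ℕ} {h : Fin K → ℝ}
    {x : (k : Fin (K + 1)) → Fin (sampleSize nT nS k) → EuclideanSpace ℝ (Fin p)}
    {e : (k : Fin (K + 1)) → Fin (sampleSize nT nS k) → ℝ}
    {β b : Fin (K + 1) → EuclideanSpace ℝ (Fin p)} (hc₀ : 0 < c₀) (hα : 0 < α) (hρ : 0 ≤ ρ)
    (hL : 0 < L) (hnS : (0 : ℝ) < nS) (hMρ : 2404 * ρ ≤ α * M) (hK : 1 ≤ K)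
    (hM : M * (s * L) ≤ nS) (hβ : β ∈ paramSpace s h) (hG : GoodEvent c₀ α ρ L x e)
    (hb : b ∈ argminSet (c₀ * √(L / totalSize K nT nS)) (fun _ => 8 * √(nS / totalSize K nT nS)) x
      (response β x e)) :
    ‖average nT nS b - average nT nS β‖ ^ 2 ≤
      2 / α * (127 * c₀ ^ 2 / α + 120 * c₀ + 44430 * ρ) *
        (s * L / totalSize K nT nS +
          (1 + √((K : ℝ) ^ 2 * L / nS) * hBar nT nS h) * hBar nT nS h * √(L / nS)) := by
  have hK1 : (1 : ℝ) ≤ K := by exact_mod_cast hK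
  have hKN : K * nS ≤ (totalSize K nT nS : ℝ) := by
    simp [totalSize]
  have hN : (0 : ℝ) < totalSize K nT nS := by nlinarith
  obtain ⟨hG1, hG2, hG3⟩ := hG
  classical
  set T : Finset (Fin p) := {j | β 0 j ≠ 0} with hTdef
  have hTs : T.card ≤ s := by
    have := hβ.1
    rw [l0Norm, Set.ncard_eq_toFinset_card'] at this
    convert this using 2
    ext j
    simp [hTdef]
  have hT : ∀ j ∉ T, β 0 j = 0 := fun j hj => by simpa [hTdef] using hj
  have hH : 0 ≤ ∑ k, h k :=
    Finset.sum_nonneg fun k _ => (l1Norm_nonneg _).trans (hβ.2 k)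
  rw [average_sub_average]
  simp only [hBar]
  set N : ℝ := ((totalSize K nT nS : ℕ) : ℝ) with hNdef
  set θ := √(L / nS) with hθ
  set τ := √(nS / N) with hτ
  have hθ2 : θ ^ 2 = L / nS := Real.sq_sqrt (by positivity)
  have hτ2 : τ ^ 2 = nS / N := Real.sq_sqrt (by positivity)
  have hθ0 : 0 < θ := Real.sqrt_pos.2 (by positivity)
  have hτ0 : 0 < τ := Real.sqrt_pos.2 (by positivity)
  have hθτ2 : θ ^ 2 * τ ^ 2 = L / N := by rw [hθ2, hτ2]; field_simp
  have hθτ : √(L / N) = θ * τ := by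
    rw [← hθτ2, ← mul_pow, Real.sqrt_sq (by positivity)]
  have hKθ : √((K : ℝ) ^ 2 * L / nS) = K * θ := by
    rw [mul_div_assoc, ← hθ2, ← mul_pow, Real.sqrt_sq (by positivity)]
  have hNL : √(N * L) = N * (θ * τ) := by
    rw [← hθτ, show N * L = N ^ 2 * (L / N) by field_simp, Real.sqrt_mul (by positivity),
      Real.sqrt_sq hN.le]
  have hnSL : √(nS * L) = N * (θ * τ * τ) := by
    rw [show nS * L = (nS : ℝ) ^ 2 * (L / nS) by field_simp, Real.sqrt_mul (by positivity),
      Real.sqrt_sq hnS.le, ← hθ]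
    have : N * (θ * τ * τ) = N * τ ^ 2 * θ := by ring
    rw [this, hτ2]
    field_simp
  rw [hθτ] at hb
  -- Here `G₀ = lam / 2` and `G₁ = lam * a / 16`, hence the factors `3/2`, `1/2` and `15/16` below.
  have B1 := quadratic_le_of_mem_argminSet (G₀ := c₀ / 2 * (θ * τ)) (G₁ := c₀ / 2 * (θ * τ * τ))
    (by positivity) (by positivity) hN hβ (fun j => (hG2 j).trans (le_of_eq (by rw [hNL]; ring)))
    (fun k j => (hG3 k j).trans (le_of_eq (by rw [hnSL]; ring))) hT hb
  have B2 := sum_abs_le_norm_average hTs hN (fun k => b k - β k)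
  have B3 := norm_average_sq_le hα (mul_nonneg hρ hL.le) hK hN (fun k => b k - β k)
    (fun k => ∑ i, inner ℝ (x k i) (b k - β k) ^ 2)
    (fun k => Finset.sum_nonneg fun _ _ => sq_nonneg _) (fun k => hG1 k _)
  have hl1 : l1Norm (b 0 - β 0) =
      ∑ j ∈ T, |(b 0 - β 0) j| + ∑ j ∈ Tᶜ, |(b 0 - β 0) j| := by
    rw [l1Norm, Finset.sum_add_sum_compl]
  rw [hl1] at B1
  simp only [hl1] at B3
  rw [← hNdef, ← hτ2] at B2 B3
  have hon : 0 ≤ ∑ j ∈ T, |(b 0 - β 0) j| := Finset.sum_nonneg fun _ _ => abs_nonneg _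
  have hoff : 0 ≤ ∑ j ∈ Tᶜ, |(b 0 - β 0) j| := Finset.sum_nonneg fun _ _ => abs_nonneg _
  have hD : 0 ≤ ∑ k : Fin K, l1Norm (b k.succ - β k.succ - (b 0 - β 0)) :=
    Finset.sum_nonneg fun _ _ => l1Norm_nonneg _
  have hQ : 0 ≤ ∑ k, ∑ i, inner ℝ (x k i) (b k - β k) ^ 2 :=
    Finset.sum_nonneg fun _ _ => Finset.sum_nonneg fun _ _ => sq_nonneg _
  have key := sq_le_of_basic_inequalities (K := K) (M := M) (σ := √s) (H := ∑ k, h k) (ρ := ρ)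
    (q := (∑ k, ∑ i, inner ℝ (x k i) (b k - β k) ^ 2) / N) hc₀ hθ0 hτ0 hα hρ hon hoff hD hH
    (norm_nonneg (average nT nS fun k => b k - β k)) (Real.sqrt_nonneg s) hK1 (by positivity)
    (by rw [hτ2]; rw [mul_div_assoc', div_le_one hN]; exact hKN) hMρ
    (by
      rw [Real.sq_sqrt (Nat.cast_nonneg _), hθ2, mul_div_assoc', mul_div_assoc', div_le_one hnS]
      exact hM)
    (by
      refine B1.trans (le_of_eq ?_)
      ring)
    B2
    (by
      refine B3.trans (le_of_eq ?_)
      rw [hθτ2]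
      ring)
  rw [Real.sq_sqrt (Nat.cast_nonneg _), hθτ2] at key
  rw [hKθ, ← hτ2, mul_div_assoc (s : ℝ)]
  exact key

/-! ### Existence of minimizers -/

lemma continuous_l1Norm {E : Type*} [TopologicalSpace E] {f : E → EuclideanSpace ℝ (Fin p)}
    (hf : Continuous f) : Continuous fun z => l1Norm (f z) := by
  unfold l1Norm
  fun_prop

/-- The co-training objective is coercive, hence has a minimizer. -/
lemma argminSet_nonempty {lam a : ℝ} (hlam : 0 < lam) (ha : 0 < a)
    (x : (k : Fin (K + 1)) → Fin (sampleSize nT nS k) → EuclideanSpace ℝ (Fin p))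
    (y : (k : Fin (K + 1)) → Fin (sampleSize nT nS k) → ℝ) :
    (argminSet lam (fun _ => a) x y).Nonempty := by
  have hcont : Continuous (objective lam (fun _ => a) x y) := by
    unfold objective
    refine Continuous.add (by fun_prop) (continuous_const.mul (Continuous.add ?_ ?_))
    · exact continuous_l1Norm (by fun_prop)
    · exact continuous_finsetSum _ fun k _ => continuous_const.mul
        (continuous_l1Norm (by fun_prop))
  set c := objective lam (fun _ => a) x y 0
  -- On the sublevel set of the value at `0` the penalty alone bounds `b 0` and every contrast, so
  -- no condition on the design is needed.
  have hpen : ∀ b, objective lam (fun _ => a) x y b ≤ c → ∀ k, ‖b k‖ ≤ c / lam + c / (lam * a) := by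
    intro b hb
    have h1 : lam * (l1Norm (b 0) + ∑ k : Fin K, a * l1Norm (b k.succ - b 0)) ≤ c := by
      refine le_trans ?_ hb
      unfold objective
      have : 0 ≤ 1 / (2 * (totalSize K nT nS : ℝ)) *
          ∑ k, ∑ i, (y k i - inner ℝ (x k i) (b k)) ^ 2 := by positivity
      linarith
    have hs : ∀ k : Fin K, 0 ≤ a * l1Norm (b k.succ - b 0) := fun k =>
      mul_nonneg ha.le (l1Norm_nonneg _)
    have hsum : 0 ≤ ∑ k : Fin K, a * l1Norm (b k.succ - b 0) :=
      Finset.sum_nonneg fun k _ => hs k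
    have h0 : l1Norm (b 0) ≤ c / lam := by
      rw [le_div_iff₀ hlam]
      nlinarith
    have hc : 0 ≤ c := le_trans (mul_nonneg hlam.le (add_nonneg (l1Norm_nonneg _) hsum)) h1
    have hca : 0 ≤ c / (lam * a) := by positivity
    intro k
    refine Fin.cases ?_ (fun k => ?_) k
    · exact (norm_le_l1Norm _).trans (by linarith)
    · have h2 : l1Norm (b k.succ - b 0) ≤ c / (lam * a) := by
        rw [le_div_iff₀ (by positivity)]
        have h3 : a * l1Norm (b k.succ - b 0) ≤ ∑ k : Fin K, a * l1Norm (b k.succ - b 0) :=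
          Finset.single_le_sum (fun k _ => hs k) (Finset.mem_univ k)
        have h4 := l1Norm_nonneg (b 0)
        nlinarith
      calc ‖b k.succ‖ = ‖b 0 + (b k.succ - b 0)‖ := by congr 1; abel
        _ ≤ ‖b 0‖ + ‖b k.succ - b 0‖ := norm_add_le _ _
        _ ≤ _ := add_le_add ((norm_le_l1Norm _).trans h0) ((norm_le_l1Norm _).trans h2)
  have hcomp : IsCompact {b | objective lam (fun _ => a) x y b ≤ c} := by
    refine Metric.isCompact_of_isClosed_isBounded (isClosed_le hcont continuous_const) ?_
    refine (Metric.isBounded_closedBall (x := 0) (r := max 0 (c / lam + c / (lam * a)))).subset ?_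
    intro b hb
    rw [mem_closedBall_zero_iff, pi_norm_le_iff_of_nonneg (le_max_left _ _)]
    exact fun k => (hpen b hb k).trans (le_max_right _ _)
  obtain ⟨b, hb, hmin⟩ := hcomp.exists_isMinOn ⟨0, show objective lam (fun _ => a) x y 0 ≤ c from le_rfl⟩ hcont.continuousOn
  refine ⟨b, fun b' => ?_⟩
  rcases le_total (objective lam (fun _ => a) x y b') c with h | h
  · exact hmin h
  · exact le_trans hb h

end TransFusion

/-! ### Choice of constants and conclusion -/

namespace TransFusion

lemma curvatureLoss_nonneg {c : ℝ} (hc : 0 < c) (κ : ℝ≥0) {R : ℝ} (hR : 0 ≤ R) :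
    0 ≤ curvatureLoss c κ R := by
  have := lowerTailRate_pos hc κ
  unfold curvatureLoss
  positivity

lemma rate_nonneg {K p s nT nS : ℕ} {h : Fin K → ℝ} (hh : ∀ k, 0 ≤ h k) :
    0 ≤ rate p s nT nS h := by
  have hsum : 0 ≤ ∑ k, h k := Finset.sum_nonneg fun k _ => hh k
  have hb : 0 ≤ hBar nT nS h := mul_nonneg (by positivity) hsum
  have hv : 0 ≤ vn p nT nS h := mul_nonneg (Real.sqrt_nonneg _) hb
  have hL : 0 ≤ Real.log p := Real.log_natCast_nonneg p
  unfold rate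
  positivity

lemma GaussianErrors.mono {Ω : Type u} [MeasurableSpace Ω] {μ : Measure Ω} {K p nT nS : ℕ}
    {V V' : ℝ≥0} {X : (k : Fin (K + 1)) → Fin (sampleSize nT nS k) → Ω → EuclideanSpace ℝ (Fin p)}
    {ε : (k : Fin (K + 1)) → Fin (sampleSize nT nS k) → Ω → ℝ} (hε : GaussianErrors μ V X ε)
    (h : V ≤ V') : GaussianErrors μ V' X ε where
  measurable := hε.measurable
  indep := hε.indep
  gaussian k i := (hε.gaussian k i).imp fun _ hv => ⟨hv.1.trans h, hv.2⟩
  indep_design := hε.indep_design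

end TransFusion

theorem theorem1 (cS : ℝ) (hcS : 0 < cS) (κ V : ℝ≥0) (A : ℝ) :
    ∃ c₀ > (0 : ℝ), ∃ M > (0 : ℝ), ∃ C > (0 : ℝ),
    ∃ c₁ > (0 : ℝ), ∃ c₂ > (0 : ℝ), ∃ c₃ > (0 : ℝ), ∃ c₄ > (0 : ℝ),
    ∀ (K nT nS p s : ℕ), 1 ≤ K → 1 ≤ s → Real.log K ≤ A * Real.log p →
      M * (s * Real.log p) ≤ nS →
    ∀ (h : Fin K → ℝ) (β : Fin (K + 1) → EuclideanSpace ℝ (Fin p)) (εD : ℝ),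
      β ∈ TransFusion.paramSpace s h →
      TransFusion.l1Norm (TransFusion.averageContrast nT nS β) ≤ εD →
    ∀ (Ω : Type u) [MeasurableSpace Ω] (μ : Measure Ω) [IsProbabilityMeasure μ]
      (S : Fin (K + 1) → Matrix (Fin p) (Fin p) ℝ)
      (X : (k : Fin (K + 1)) → Fin (TransFusion.sampleSize nT nS k) → Ω →
        EuclideanSpace ℝ (Fin p))
      (ε : (k : Fin (K + 1)) → Fin (TransFusion.sampleSize nT nS k) → Ω → ℝ),
      TransFusion.SubGaussianDesigns μ cS κ S X →
      TransFusion.GaussianErrors μ V X ε →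
    ∃ E : Set Ω, MeasurableSet E ∧
      1 - c₁ * Real.exp (-(c₂ * nT)) - c₃ * Real.exp (-(c₄ * Real.log p)) ≤ μ.real E ∧
      ∀ ω ∈ E,
        (TransFusion.argminSet
          (c₀ * √(Real.log p / (TransFusion.totalSize K nT nS : ℝ)))
          (fun _ => 8 * √((nS : ℝ) / (TransFusion.totalSize K nT nS : ℝ)))
          (fun k i => X k i ω)
          (TransFusion.response β (fun k i => X k i ω) (fun k i => ε k i ω))).Nonempty ∧
        ∀ b ∈ TransFusion.argminSet
          (c₀ * √(Real.log p / (TransFusion.totalSize K nT nS : ℝ)))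
          (fun _ => 8 * √((nS : ℝ) / (TransFusion.totalSize K nT nS : ℝ)))
          (fun k i => X k i ω)
          (TransFusion.response β (fun k i => X k i ω) (fun k i => ε k i ω)),
          ‖TransFusion.average nT nS b - TransFusion.average nT nS β‖ ^ 2
            ≤ C * TransFusion.rate p s nT nS h ∧
          ‖TransFusion.average nT nS b - β 0‖ ^ 2
            ≤ C * (TransFusion.rate p s nT nS h + εD ^ 2) := by
  classical
  set A' : ℝ := max A 0
  have hA' : 0 ≤ A' := le_max_right _ _
  -- Raising the proxies keeps the hypotheses true and makes them strictly positive, so that one may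
  -- divide by them and `c₀ > 0`.
  set κ' : ℝ≥0 := κ + 1
  have hκ' : 0 < κ' := by positivity
  set V' : ℝ≥0 := V + 1
  have hV' : 0 < V' := by positivity
  have hκr : (0 : ℝ) < κ' := hκ'
  have hVr : (0 : ℝ) < V' := hV'
  set c₀ : ℝ := √(8 * (4 * κ' * (1 + 2 * (A' + 2))) * V' * (A' + 2)) with hc₀def
  have hc₀ : 0 < c₀ := Real.sqrt_pos.2 (by positivity)
  set α : ℝ := 1 / (4 * cS)
  have hα : 0 < α := by positivity
  set ρ : ℝ := TransFusion.curvatureLoss cS κ' (A' + 2)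
  have hρ : 0 ≤ ρ := TransFusion.curvatureLoss_nonneg hcS κ' (by positivity)
  set C₁ : ℝ := 2 / α * (127 * c₀ ^ 2 / α + 120 * c₀ + 44430 * ρ)
  have hC₁ : 0 ≤ C₁ := by positivity
  refine ⟨c₀, hc₀, 2404 * ρ / α + 1, by positivity, 2 * C₁ + 2, by positivity, 1, one_pos, 1,
    one_pos, 8, by norm_num, 1, one_pos, ?_⟩
  intro K nT nS p s hK hs hKA hM h β εD hβ hεD Ω _ μ _ S X ε hX hε
  rcases Nat.lt_or_ge p 2 with hp | hp
  -- For `p ≤ 1`, `log p = 0` and the required probability is negative.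
  · refine ⟨∅, MeasurableSet.empty, ?_, fun ω hω => absurd hω (Set.notMem_empty ω)⟩
    have hlog : Real.log p = 0 := by
      interval_cases p <;> simp
    rw [hlog]
    have := Real.exp_pos (-(1 * (nT : ℝ)))
    simp only [mul_zero, neg_zero, Real.exp_zero, measureReal_empty]
    linarith
  have hp2 : (2 : ℝ) ≤ p := by exact_mod_cast hp
  have hL : 0 < Real.log p := Real.log_pos (by linarith)
  have hs1 : (1 : ℝ) ≤ s := by exact_mod_cast hs
  have hM1 : 1 ≤ 2404 * ρ / α + 1 := by
    have : 0 ≤ 2404 * ρ / α := by positivity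
    linarith
  have hnSL : Real.log p ≤ nS := by
    refine le_trans ?_ hM
    have h1 : Real.log p ≤ s * Real.log p := by nlinarith
    have h2 : 0 ≤ s * Real.log p := by positivity
    nlinarith
  have hnS : (0 : ℝ) < nS := hL.trans_le hnSL
  have hK1 : (1 : ℝ) ≤ K := by exact_mod_cast hK
  have hN : (0 : ℝ) < TransFusion.totalSize K nT nS := by
    simp only [TransFusion.totalSize]
    push_cast
    positivity
  have hX' := hX.mono (κ' := κ') (by simp [κ'])
  have hε' := hε.mono (V' := V') (by simp [V'])
  obtain ⟨Bad, hBad, hgood⟩ := TransFusion.exists_goodEvent hX' hε' hcS hκ' hV' hA' hK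
    (hKA.trans (mul_le_mul_of_nonneg_right (le_max_left _ _) hL.le)) hp hnSL
  -- The measurable hull has the same measure as `Bad` and supplies a measurable event.
  refine ⟨(toMeasurable μ Bad)ᶜ, (measurableSet_toMeasurable _ _).compl, ?_, ?_⟩
  · rw [probReal_compl_eq_one_sub (measurableSet_toMeasurable _ _), measureReal_def,
      measure_toMeasurable, ← measureReal_def]
    have := Real.exp_pos (-(1 * (nT : ℝ)))
    rw [one_mul (Real.log p)]
    linarith
  · intro ω hω
    have hG := hgood ω fun hb => hω (subset_toMeasurable _ _ hb)
    refine ⟨TransFusion.argminSet_nonempty (by positivity) (by positivity) _ _, fun b hb => ?_⟩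
    have main : ‖TransFusion.average nT nS b - TransFusion.average nT nS β‖ ^ 2 ≤
        C₁ * TransFusion.rate p s nT nS h :=
      TransFusion.norm_average_sub_sq_le hc₀ hα hρ hL hnS
        (M := 2404 * ρ / α + 1) (by rw [mul_add, mul_div_cancel₀ _ hα.ne']; linarith)
        hK hM hβ hG hb
    have hrate : 0 ≤ TransFusion.rate p s nT nS h := TransFusion.rate_nonneg fun k =>
      (TransFusion.l1Norm_nonneg _).trans (hβ.2 k)
    refine ⟨main.trans (mul_le_mul_of_nonneg_right (by linarith) hrate), ?_⟩
    have hbias : ‖TransFusion.average nT nS β - β 0‖ ≤ εD := by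
      rw [TransFusion.average_eq hN, add_sub_cancel_left]
      exact (TransFusion.norm_le_l1Norm _).trans hεD
    have htri : ‖TransFusion.average nT nS b - β 0‖ ^ 2 ≤
        2 * (‖TransFusion.average nT nS b - TransFusion.average nT nS β‖ ^ 2 + εD ^ 2) := by
      refine le_trans ?_ add_sq_le
      refine pow_le_pow_left₀ (norm_nonneg _) ?_ 2
      exact (norm_sub_le_norm_sub_add_norm_sub _ _ _).trans (by gcongr)
    nlinarith [mul_nonneg hC₁ (sq_nonneg εD)]
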